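/- Let $\overline{\mathbb Q}$ be an algebraic closure of $\mathbb Q$ and let $Y$ be the set of all places $y$ of $\overline{\mathbb Q}$. For $y\in Y$ let $\|\cdot\|_y$ be the absolute value in $y$ whose restriction to $\mathbb Q$ is the usual absolute value or the usual $p$-adic absolute value for a prime $p$. For a field $k\subseteq\overline{\mathbb Q}$ and a place $v$ of $k$ let $Y(k,v)$ be the set of $y\in Y$ lying over $v$. Give $Y$ the (locally compact, totally disconnected) topology generated by the sets $Y(k,v)$, where $k/\mathbb Q$ runs over the finite Galois extensions and $v$ over the places of $k$. The group $\mathrm{Aut}(\overline{\mathbb Q}/\mathbb Q)$ acts on $Y$ by $\|\alpha\|_{\tau y}=\|\tau^{-1}\alpha\|_y$. Let $\lambda$ be the $\mathrm{Aut}(\overline{\mathbb Q}/\mathbb Q)$-invariant regular measure on the Borel $\sigma$-algebra $\mathcal B$ of $Y$, normalized by $\lambda(Y(k,v))=[k_v:\mathbb Q_v]/[k:\mathbb Q]$ for all finite Galois $k/\mathbb Q$ and all $v$. Equivalently, $\lambda$ is the sum over the places $u$ of $\mathbb Q$ of the images of the normalized Haar measure of $\mathrm{Aut}(\overline{\mathbb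 Q}/\mathbb Q)$ under the orbit maps $\tau\mapsto\tau y_u$, where $y_u$ is any place over $u$. Let $$\mathcal X=\Big\{F\in L^1(Y,\mathcal B,\lambda)\ (\text{real valued}) : \int_Y F\,d\lambda=0\Big\}$$ with the $L^1$-norm. Let $\mathbb Q\subseteq K\subseteq\overline{\mathbb Q}$ be a field, that is, an algebraic extension of $\mathbb Q$. For each $\alpha\in K^\times$ the function $f_\alpha(y)=\log\|\alpha\|_y$ belongs to $\mathcal X$. Let $\mathcal D_K\subseteq\mathcal X$ be the $\mathbb Q$-linear span of $\{f_\alpha:\alpha\in K^\times\}$, and let $\mathcal X_K$ be the closure of $\mathcal D_K$ in $\mathcal X$, which is a closed $\mathbb R$-linear subspace. Let $\nu_K$ be the Haar measure of total mass $1$ on the compact group $\mathrm{Aut}(\overline{\mathbb Q}/K)$. **Theorem.** For each $F\in\mathcal X$ and $\lambda$-almost every $y\in Y$ the function $\tau\mapsto F(\tau^{-1}y)$ is $\nu_K$-integrable, and $$U_K(F)(y)=\int_{\mathrm{Aut}(\overline{\mathbb Q}/K)}F(\tau^{-1}y)\,d\nu_K(\tau)\qquad\text{for }\lambda\text{-almost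 every }y$$ defines a unique map $U_K:\mathcal X\to\mathcal X$. This map is a continuous $\mathbb R$-linear operator with $U_K\circ U_K=U_K$ and with image exactly $\mathcal X_K$. Therefore $$\mathcal X=\mathcal X_K\oplus\mathcal Y_K,\qquad \mathcal Y_K=\ker U_K,$$ and $\mathcal X_K$ is a complemented subspace of $\mathcal X$, i.e. the image of a continuous linear projection. -/

import Mathlib

open MeasureTheory TopologicalSpace

noncomputable section

namespace WeilHeight

/-- A place of a field `L` of characteristic zero, algebraic over `ℚ`, given by its normalized
absolute value: the unique representative of the place whose restriction to `ℚ` is the usual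
absolute value or the usual `p`-adic absolute value for a prime `p`. -/
@[ext]
structure Place (L : Type*) [Field L] where
  abv : AbsoluteValue L ℝ
  normalized : (∀ q : ℚ, abv (q : L) = |(q : ℝ)|) ∨
    ∃ p : ℕ, p.Prime ∧ ∀ q : ℚ, abv (q : L) = (padicNorm p q : ℝ)

/-- Pull-back of a place along a field homomorphism, `‖x‖_{comap f y} = ‖f x‖_y`.  For an inclusion
of fields this is restriction of places: `y ∣ v` means `comap (inclusion) y = v`. -/
def Place.comap {L M : Type*} [Field L] [Field M] (f : L →+* M) (y : Place M) : Place L where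
  abv := y.abv.comp f.injective
  normalized := by
    have h : ∀ q : ℚ, y.abv.comp f.injective (q : L) = y.abv (q : M) := fun q => by
      change y.abv (f (q : L)) = _
      rw [map_ratCast]
    simpa only [h] using y.normalized

/-- The Galois action on places, `‖x‖_{τ y} = ‖τ⁻¹ x‖_y`. -/
instance {k L : Type*} [Field k] [Field L] [Algebra k L] : MulAction (L ≃ₐ[k] L) (Place L) where
  smul τ y := y.comap ((τ⁻¹ : L ≃ₐ[k] L) : L →+* L)
  one_smul y := by
    ext x
    rfl
  mul_smul σ τ y := by
    ext x
    change y.abv ((σ * τ)⁻¹ x) = y.abv (τ⁻¹ (σ⁻¹ x))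
    rw [mul_inv_rev]
    rfl

theorem smul_abv {k L : Type*} [Field k] [Field L] [Algebra k L] (τ : L ≃ₐ[k] L) (y : Place L)
    (x : L) : (τ • y).abv x = y.abv (τ⁻¹ x) := rfl

/-- The algebraic closure of `ℚ`. -/
abbrev Qbar : Type := AlgebraicClosure ℚ

instance : Algebra.IsAlgebraic ℚ Qbar := AlgebraicClosure.isAlgebraic ℚ

instance : IsAlgClosure ℚ Qbar := ⟨inferInstance, inferInstance⟩

instance : IsGalois ℚ Qbar where
  to_isSeparable := inferInstance
  to_normal := IsAlgClosure.normal ℚ Qbar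

/-- The set `Y(k, v)` of places of `Qbar` lying over the place `v` of `k`. -/
def placesOver (k : IntermediateField ℚ Qbar) (v : Place k) : Set (Place Qbar) :=
  {y | y.comap (algebraMap k Qbar) = v}

/-- The topology of the space `Y` of places of `Qbar`: the inverse limit topology coming from the
discrete sets of places of the finite Galois extensions `k/ℚ`, that is, the topology generated by
all the sets `Y(k, v)`. -/
instance : TopologicalSpace (Place Qbar) :=
  generateFrom {U | ∃ k : IntermediateField ℚ Qbar,
    FiniteDimensional ℚ k ∧ IsGalois ℚ k ∧ ∃ v : Place k, U = placesOver k v}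

instance : MeasurableSpace (Place Qbar) := borel _

instance : BorelSpace (Place Qbar) := ⟨rfl⟩

/-- The Borel `σ`-algebra of the profinite group `Aut(Qbar/k)` (with the Krull topology). -/
instance {k : Type*} [Field k] [Algebra k Qbar] : MeasurableSpace (Qbar ≃ₐ[k] Qbar) := borel _

instance {k : Type*} [Field k] [Algebra k Qbar] : BorelSpace (Qbar ≃ₐ[k] Qbar) := ⟨rfl⟩

/-- The Haar measure on the compact group `Aut(Qbar/k)`, normalized to have total mass `1`. -/
def haarAut (k : Type*) [Field k] [Algebra k Qbar] [IsGalois k Qbar] :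
    Measure (Qbar ≃ₐ[k] Qbar) :=
  Measure.haarMeasure ⊤

instance (k : Type*) [Field k] [Algebra k Qbar] [IsGalois k Qbar] :
    IsProbabilityMeasure (haarAut k) :=
  ⟨Measure.haarMeasure_self (G := Qbar ≃ₐ[k] Qbar) (K₀ := ⊤)⟩

instance (k : Type*) [Field k] [Algebra k Qbar] [IsGalois k Qbar] :
    (haarAut k).IsHaarMeasure :=
  Measure.isHaarMeasure_haarMeasure _

/-- Every place of `ℚ` extends to `Qbar`. -/
theorem exists_place_over (u : Place ℚ) :
    ∃ y : Place Qbar, y.comap (algebraMap ℚ Qbar) = u := by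
  rcases u with ⟨u, hu⟩
  rcases id hu with h | ⟨p, hp, h⟩
  · let f : Qbar →ₐ[ℚ] ℂ := IsAlgClosed.lift
    have key : ∀ q : ℚ, ‖f (q : Qbar)‖ = |(q : ℝ)| := by
      intro q
      rw [map_ratCast, ← Complex.ofReal_ratCast, Complex.norm_real, Real.norm_eq_abs]
    refine ⟨⟨(NormedField.toAbsoluteValue ℂ).comp f.toRingHom.injective, Or.inl key⟩, ?_⟩
    ext q
    have := key q
    have h2 := h q
    simp only [Rat.cast_id] at h2
    rw [h2]
    rw [← this]
    change ‖f (algebraMap ℚ Qbar q)‖ = _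
    rw [eq_ratCast]
  · have : Fact p.Prime := ⟨hp⟩
    let f : Qbar →ₐ[ℚ] PadicAlgCl p := IsAlgClosed.lift
    have key : ∀ q : ℚ, ‖f (q : Qbar)‖ = (padicNorm p q : ℝ) := by
      intro q
      rw [map_ratCast, ← map_ratCast (algebraMap ℚ_[p] (PadicAlgCl p)), PadicAlgCl.norm_extends,
        Padic.eq_padicNorm]
    refine ⟨⟨(NormedField.toAbsoluteValue (PadicAlgCl p)).comp f.toRingHom.injective,
      Or.inr ⟨p, hp, key⟩⟩, ?_⟩
    ext q
    have := key q
    have h2 := h q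
    simp only [Rat.cast_id] at h2
    rw [h2]
    rw [← this]
    change ‖f (algebraMap ℚ Qbar q)‖ = _
    rw [eq_ratCast]

/-- A chosen place of `Qbar` over the place `u` of `ℚ`. -/
def basePlace (u : Place ℚ) : Place Qbar := (exists_place_over u).choose

theorem basePlace_comap (u : Place ℚ) : (basePlace u).comap (algebraMap ℚ Qbar) = u :=
  (exists_place_over u).choose_spec

/-- The `Aut(Qbar/ℚ)`-invariant measure `λ` on the Borel subsets of `Y`, normalized so that the set
`Y(ℚ, u)` of all places over `u` has measure `1` for each place `u` of `ℚ`.  As `Aut(Qbar/ℚ)` acts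
transitively on `Y(ℚ, u)`, the restriction of `λ` to `Y(ℚ, u)` is the image of normalized Haar
measure under an orbit map `τ ↦ τ y`.  Equivalently, `λ(Y(k, v)) = [k_v : ℚ_v] / [k : ℚ]` for every
finite Galois extension `k/ℚ` and every place `v` of `k`: for such `k` both sides are equal to
`1/g`, where `g` is the number of places of `k` over the place of `ℚ` below `v`. -/
def placeMeasure : Measure (Place Qbar) :=
  Measure.sum fun u : Place ℚ =>
    (haarAut ℚ).map fun τ : Qbar ≃ₐ[ℚ] Qbar => τ • basePlace u

/-- Orbit maps are continuous, hence the image measures in `placeMeasure` are not degenerate. -/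
theorem continuous_orbit (y : Place Qbar) : Continuous fun τ : Qbar ≃ₐ[ℚ] Qbar => τ • y := by
  refine continuous_generateFrom_iff.2 ?_
  rintro _ ⟨k, hk, -, v, rfl⟩
  rw [isOpen_iff_mem_nhds]
  intro τ hτ
  have hopen : IsOpen {σ : Qbar ≃ₐ[ℚ] Qbar | σ * τ⁻¹ ∈ k.fixingSubgroup} :=
    (IntermediateField.fixingSubgroup_isOpen k).preimage (continuous_mul_const τ⁻¹)
  refine Filter.mem_of_superset (hopen.mem_nhds (by simp)) ?_
  intro σ hσ
  have hτ' : (τ • y).comap (algebraMap k Qbar) = v := hτ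
  change (σ • y).comap (algebraMap k Qbar) = v
  rw [← hτ']
  ext x
  change y.abv (σ⁻¹ (x : Qbar)) = y.abv (τ⁻¹ (x : Qbar))
  have h1 : (σ * τ⁻¹)⁻¹ (x : Qbar) = x :=
    (IntermediateField.mem_fixingSubgroup_iff _ _).1 (inv_mem hσ) x x.2
  rw [mul_inv_rev, inv_inv] at h1
  have h2 : τ (σ⁻¹ (x : Qbar)) = x := h1
  exact congrArg y.abv ((τ.symm_apply_apply (σ⁻¹ (x : Qbar))).symm.trans (congrArg τ.symm h2))

/-- The Galois action on `Y` is by continuous maps. -/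
theorem continuous_smul_place (σ : Qbar ≃ₐ[ℚ] Qbar) :
    Continuous fun y : Place Qbar => σ • y := by
  refine continuous_generateFrom_iff.2 ?_
  rintro _ ⟨k, hk, hgal, v, rfl⟩
  have hset : (fun y : Place Qbar => σ • y) ⁻¹' placesOver k v =
      ⋃ w ∈ {w : Place k | ∃ y : Place Qbar, σ • y ∈ placesOver k v ∧ y ∈ placesOver k w},
        placesOver k w := by
    ext y
    simp only [Set.mem_preimage, Set.mem_iUnion, Set.mem_ofPred_eq, exists_prop]
    constructor
    · intro hy
      exact ⟨y.comap (algebraMap k Qbar), ⟨y, hy, rfl⟩, rfl⟩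
    · rintro ⟨w, ⟨z, hz, hzw⟩, hyw⟩
      have hz' : (σ • z).comap (algebraMap k Qbar) = v := hz
      have hzy : z.comap (algebraMap k Qbar) = y.comap (algebraMap k Qbar) :=
        Eq.trans hzw (Eq.symm hyw)
      change (σ • y).comap (algebraMap k Qbar) = v
      rw [← hz']
      ext x
      change y.abv (σ⁻¹ (x : Qbar)) = z.abv (σ⁻¹ (x : Qbar))
      have hmem : σ⁻¹ (x : Qbar) ∈ k := by
        have hle := IntermediateField.normal_iff_forall_map_le'.1
          (inferInstance : Normal ℚ k) σ⁻¹
        exact hle ⟨x, x.2, rfl⟩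
      exact (congrArg (fun u : Place k => u.abv ⟨σ⁻¹ (x : Qbar), hmem⟩) hzy).symm
  rw [hset]
  exact isOpen_biUnion fun w _ => isOpen_generateFrom_of_mem ⟨k, hk, hgal, w, rfl⟩

/-- `λ` is invariant under the Galois action. -/
theorem placeMeasure_map_smul (σ : Qbar ≃ₐ[ℚ] Qbar) :
    placeMeasure.map (fun y => σ • y) = placeMeasure := by
  have hσ := (continuous_smul_place σ).measurable
  rw [placeMeasure, Measure.map_sum hσ.aemeasurable]
  congr 1
  funext u
  have ho := (continuous_orbit (basePlace u)).measurable
  rw [Measure.map_map hσ ho]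
  have hcomp : ((fun y => σ • y) ∘ fun τ : Qbar ≃ₐ[ℚ] Qbar => τ • basePlace u) =
      (fun τ : Qbar ≃ₐ[ℚ] Qbar => τ • basePlace u) ∘ fun τ => σ * τ := by
    funext τ
    exact (mul_smul σ τ (basePlace u)).symm
  rw [hcomp, ← Measure.map_map ho (measurable_const_mul σ),
    MeasureTheory.map_mul_left_eq_self]

/-- The set `Y(ℚ, u)` of all places over a place `u` of `ℚ` has `λ`-measure `1`. -/
theorem placeMeasure_over (u : Place ℚ) :
    placeMeasure {y : Place Qbar | y.comap (algebraMap ℚ Qbar) = u} = 1 := by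
  have hset : {y : Place Qbar | y.comap (algebraMap ℚ Qbar) = u} =
      ⋃ w ∈ {w : Place (⊥ : IntermediateField ℚ Qbar) |
        w.comap (algebraMap ℚ (⊥ : IntermediateField ℚ Qbar)) = u}, placesOver ⊥ w := by
    ext y
    simp only [Set.mem_iUnion, Set.mem_ofPred_eq, exists_prop]
    constructor
    · intro hy
      exact ⟨y.comap (algebraMap _ Qbar), hy, rfl⟩
    · rintro ⟨w, hw, hy⟩
      have hy' : y.comap (algebraMap _ Qbar) = w := hy
      rw [← hw, ← hy']
      rfl
  have hopen : IsOpen {y : Place Qbar | y.comap (algebraMap ℚ Qbar) = u} := by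
    rw [hset]
    exact isOpen_biUnion fun w _ =>
      isOpen_generateFrom_of_mem ⟨⊥, inferInstance, isGalois_bot, w, rfl⟩
  rw [placeMeasure, Measure.sum_apply _ hopen.measurableSet, tsum_eq_single u]
  · rw [Measure.map_apply (continuous_orbit _).measurable hopen.measurableSet]
    convert measure_univ (μ := haarAut ℚ)
    refine Set.eq_univ_of_forall fun τ => ?_
    change (τ • basePlace u).comap (algebraMap ℚ Qbar) = u
    conv_rhs => rw [← basePlace_comap u]
    ext q
    exact congrArg (basePlace u).abv (AlgEquiv.commutes τ⁻¹ q)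
  · intro u' hu'
    rw [Measure.map_apply (continuous_orbit _).measurable hopen.measurableSet]
    convert measure_empty (μ := haarAut ℚ)
    refine Set.eq_empty_of_forall_notMem fun τ hτ => hu' ?_
    have hτ' : (τ • basePlace u').comap (algebraMap ℚ Qbar) = u := hτ
    rw [← hτ']
    conv_lhs => rw [← basePlace_comap u']
    ext q
    exact (congrArg (basePlace u').abv (AlgEquiv.commutes τ⁻¹ q)).symm

/-- The real Banach space `L¹(Y, 𝓑, λ)`. -/
abbrev L1 : Type := Lp ℝ 1 placeMeasure

/-- The closed subspace of functions in `L¹(Y, 𝓑, λ)` with integral zero. -/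
def X : Submodule ℝ L1 where
  carrier := {F | ∫ y, F y ∂placeMeasure = 0}
  add_mem' := by
    intro F G hF hG
    change ∫ y, (F + G : L1) y ∂placeMeasure = 0
    rw [integral_congr_ae (Lp.coeFn_add F G)]
    simp only [Pi.add_apply]
    rw [integral_add (L1.integrable_coeFn F) (L1.integrable_coeFn G)]
    simp_all
  zero_mem' := by
    change ∫ y, (0 : L1) y ∂placeMeasure = 0
    rw [integral_congr_ae (Lp.coeFn_zero ℝ 1 placeMeasure)]
    simp
  smul_mem' := by
    intro c F hF
    change ∫ y, (c • F : L1) y ∂placeMeasure = 0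
    rw [integral_congr_ae (Lp.coeFn_smul c F)]
    simp only [Pi.smul_apply, integral_smul]
    simp_all

/-- The function `f_α(y) = log ‖α‖_y` on `Y`. -/
def logAbs (α : Qbar) (y : Place Qbar) : ℝ := Real.log (y.abv α)

/-- The set `𝓕_K` of the elements `f_α` of `X` with `α ∈ Kˣ`. -/
def FK (K : IntermediateField ℚ Qbar) : Set X :=
  {F | ∃ α ∈ K, α ≠ 0 ∧ ((F : L1) : Place Qbar → ℝ) =ᵐ[placeMeasure] logAbs α}

/-- The `ℚ`-linear span `𝓓_K` of `𝓕_K`. -/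
def DK (K : IntermediateField ℚ Qbar) : Submodule ℚ X := Submodule.span ℚ (FK K)

/-- The closed real subspace `X_K` of `X`, the closure of `𝓓_K` in `L¹`-norm. -/
def XK (K : IntermediateField ℚ Qbar) : Submodule ℝ X where
  carrier := closure (DK K : Set X)
  add_mem' := by
    intro F G hF hG
    exact (DK K).toAddSubgroup.topologicalClosure.add_mem hF hG
  zero_mem' := subset_closure (DK K).zero_mem
  smul_mem' := by
    intro c F hF
    have hq : ∀ q : ℚ, (q : ℝ) • F ∈ closure (DK K : Set X) := by
      intro q
      refine map_mem_closure (f := fun G : X => (q : ℝ) • G) (continuous_const_smul _) hF ?_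
      intro G hG
      have : (q : ℝ) • G = q • G := by
        ext1
        exact Rat.cast_smul_eq_qsmul ℝ q (G : L1)
      change (q : ℝ) • G ∈ DK K
      rw [this]
      exact (DK K).smul_mem q hG
    have hcl : IsClosed {c : ℝ | c • F ∈ closure (DK K : Set X)} :=
      isClosed_closure.preimage (continuous_id.smul continuous_const)
    exact Rat.isDenseEmbedding_coe_real.dense.induction_on
      (p := fun c : ℝ => c • F ∈ closure (DK K : Set X)) c hcl hq

/-- `U : X → X` is given by averaging over `Aut(Qbar/K)`: for each `F` in `X` and `λ`-almost all `y`
the function `τ ↦ F(τ⁻¹ y)` is integrable and `U(F)(y) = ∫ F(τ⁻¹ y) dν_K(τ)`. -/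
def IsAveraging (K : IntermediateField ℚ Qbar) (U : X → X) : Prop :=
  ∀ F : X, ∀ᵐ y ∂placeMeasure,
    Integrable (fun τ : Qbar ≃ₐ[K] Qbar => (F : L1) (τ⁻¹ • y)) (haarAut K) ∧
      (U F : L1) y = ∫ τ : Qbar ≃ₐ[K] Qbar, (F : L1) (τ⁻¹ • y) ∂haarAut K

end WeilHeight

end

/-! `U_K` is averaging over the compact group `Aut(Qbar/K)`. Because `λ` is Galois invariant, `(y,
τ) ↦ τ⁻¹ y` carries `λ × ν_K` to `λ` (`measurePreserving_inv_smul`). Fubini then gives almost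
everywhere integrability, preservation of the integral and the bound `‖U_K F‖ ≤ ‖F‖`.

On logarithms the average is explicit: it sends `f_α` to `n⁻¹ f_β`, where `β ∈ K` is the product of
the `n` distinct conjugates of `α` over `K` (`exists_integral_log_abv_eq`), and it fixes `f_α` for
`α ∈ K`. By linearity and continuity `U_K` is the identity on `X_K`. Its values all lie in `X_K` as
soon as the `f_α` with `α ∈ Qbarˣ` span a dense subspace of `X`.

That density (`XK_top`) is the arithmetic part. The indicators of the sets `Y(k, v)` span a dense
subspace of `L¹` by a Dynkin argument in each fibre over a place of `ℚ` (`eq_top_of_placesOver`).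
Modulo the indicator of all infinite places, which spans a complement of `X`, each such indicator is
a real combination of functions `f_α`: Dirichlet's unit theorem handles infinite `v`, and finiteness
of the class group reduces finite `v` to these (`placeIndicator_mem_logSpan`). -/

noncomputable section

namespace WeilHeight

/-! ### Places over the places of `ℚ`, and the product formula for `ℚ`. -/

section PlaceBasics

variable {L : Type*} [Field L]

/-- A place lying over the prime `p` of `ℚ`. -/
def Place.IsOverPrime (y : Place L) (p : ℕ) : Prop :=
  p.Prime ∧ ∀ q : ℚ, y.abv (q : L) = (padicNorm p q : ℝ)

/-- A place lying over the infinite place of `ℚ`. -/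
def Place.IsInfinite (y : Place L) : Prop := ∀ q : ℚ, y.abv (q : L) = |(q : ℝ)|

theorem Place.isInfinite_or (y : Place L) : y.IsInfinite ∨ ∃ p, y.IsOverPrime p := by
  rcases y.normalized with h | ⟨p, hp, h⟩
  · exact Or.inl h
  · exact Or.inr ⟨p, hp, h⟩

/-- The place of `ℚ` below a given place. -/
def Place.res [Algebra ℚ L] (y : Place L) : Place ℚ := y.comap (algebraMap ℚ L)

theorem Place.abv_ratCast [Algebra ℚ L] (y : Place L) (q : ℚ) : y.abv (q : L) = y.res.abv q := by
  rw [← eq_ratCast (algebraMap ℚ L) q]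
  rfl

theorem Place.res_abv [Algebra ℚ L] (y : Place L) (q : ℚ) :
    y.res.abv q = y.abv (algebraMap ℚ L q) := rfl

theorem Place.isInfinite_res [Algebra ℚ L] {y : Place L} : y.res.IsInfinite ↔ y.IsInfinite := by
  simp only [Place.IsInfinite, Place.abv_ratCast y, Rat.cast_id]

theorem Place.isOverPrime_res [Algebra ℚ L] {y : Place L} {p : ℕ} :
    y.res.IsOverPrime p ↔ y.IsOverPrime p := by
  simp only [Place.IsOverPrime, Place.abv_ratCast y, Rat.cast_id]

theorem Place.res_comap {M : Type*} [Field M] [Algebra ℚ L] [Algebra ℚ M] (f : L →+* M)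
    (y : Place M) : (y.comap f).res = y.res := by
  ext q
  change y.abv (f (algebraMap ℚ L q)) = y.abv (algebraMap ℚ M q)
  simp

theorem Place.IsOverPrime.abv_natCast_self {y : Place L} {p : ℕ} (h : y.IsOverPrime p) :
    y.abv (p : L) = (p : ℝ)⁻¹ := by
  have := h.2 p
  rw [padicNorm.padicNorm_p h.1.one_lt] at this
  simpa using this

theorem Place.IsOverPrime.abv_intCast_le {y : Place L} {p : ℕ} (h : y.IsOverPrime p) (n : ℤ) :
    y.abv (n : L) ≤ 1 := by
  have : Fact p.Prime := ⟨h.1⟩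
  have h2 := h.2 n
  rw [Rat.cast_intCast] at h2
  rw [h2]
  exact_mod_cast padicNorm.of_int n

theorem Place.IsOverPrime.isNonarchimedean {y : Place L} {p : ℕ} (h : y.IsOverPrime p) :
    IsNonarchimedean y.abv := by
  have : IsUltrametricDist (WithAbs y.abv) := by
    refine IsUltrametricDist.isUltrametricDist_of_forall_norm_natCast_le_one fun n => ?_
    have h1 := WithAbs.norm_toAbs_eq y.abv (n : L)
    have h2 : WithAbs.toAbs y.abv (n : L) = (n : WithAbs y.abv) :=
      map_natCast (WithAbs.equiv y.abv).symm n
    rw [← h2, h1]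
    simpa using h.abv_intCast_le n
  intro a b
  have h1 := IsUltrametricDist.norm_add_le_max (WithAbs.toAbs y.abv a) (WithAbs.toAbs y.abv b)
  rwa [← WithAbs.toAbs_add, WithAbs.norm_toAbs_eq, WithAbs.norm_toAbs_eq,
    WithAbs.norm_toAbs_eq] at h1

/-- If `|x| > 1`, the leading term of a monic integral equation would strictly dominate all the
others, which the ultrametric inequality forbids. -/
theorem Place.IsOverPrime.abv_le_one_of_isIntegral {y : Place L} {p : ℕ} (h : y.IsOverPrime p)
    {x : L} (hx : IsIntegral ℤ x) : y.abv x ≤ 1 := by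
  by_contra! hlt
  obtain ⟨P, hP, hPx⟩ := hx
  rw [Polynomial.eval₂_eq_sum_range, Finset.sum_range_succ, hP.coeff_natDegree, map_one, one_mul,
    add_eq_zero_iff_eq_neg'] at hPx
  have hn : P.natDegree ≠ 0 := by
    intro h0
    rw [h0] at hPx
    simp at hPx
  have hne : (Finset.range P.natDegree).Nonempty := ⟨0, by simp; omega⟩
  obtain ⟨i, hi, hle⟩ := h.isNonarchimedean.finset_image_add_of_nonempty
    (fun i => (algebraMap ℤ L) (P.coeff i) * x ^ i) hne
  rw [← y.abv.map_neg, ← hPx, map_mul, map_pow, map_pow, eq_intCast] at hle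
  have h1 : y.abv x ^ P.natDegree ≤ y.abv x ^ i :=
    hle.trans (mul_le_of_le_one_left (by positivity) (h.abv_intCast_le _))
  exact absurd h1 (not_le.2 (pow_lt_pow_right₀ hlt (Finset.mem_range.1 hi)))

theorem Place.eq_of_isInfinite {u v : Place ℚ} (hu : u.IsInfinite) (hv : v.IsInfinite) :
    u = v := by
  ext q
  have h1 := hu q
  have h2 := hv q
  simp only [Rat.cast_id] at h1 h2
  rw [h1, h2]

theorem Place.eq_of_isOverPrime {u v : Place ℚ} {p : ℕ} (hu : u.IsOverPrime p)
    (hv : v.IsOverPrime p) : u = v := by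
  ext q
  have h1 := hu.2 q
  have h2 := hv.2 q
  simp only [Rat.cast_id] at h1 h2
  rw [h1, h2]

/-- The infinite place of `ℚ`. -/
def infPlace : Place ℚ := ⟨Rat.AbsoluteValue.real, Or.inl fun q => by simp⟩

theorem isInfinite_infPlace : infPlace.IsInfinite := fun q => by simp [infPlace]

/-- The place of `ℚ` attached to a prime. -/
def primePlace (p : Nat.Primes) : Place ℚ :=
  haveI : Fact p.1.Prime := ⟨p.2⟩
  ⟨Rat.AbsoluteValue.padic p, Or.inr ⟨p, p.2, fun q => by simp⟩⟩

theorem isOverPrime_primePlace (p : Nat.Primes) : (primePlace p).IsOverPrime p :=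
  ⟨p.2, fun q => by simp [primePlace]⟩

theorem eq_infPlace_or_primePlace (u : Place ℚ) : u = infPlace ∨ ∃ p, u = primePlace p := by
  rcases u.isInfinite_or with h | ⟨p, h⟩
  · exact Or.inl (Place.eq_of_isInfinite h isInfinite_infPlace)
  · exact Or.inr ⟨⟨p, h.1⟩, Place.eq_of_isOverPrime h (isOverPrime_primePlace ⟨p, h.1⟩)⟩

instance : Countable (Place ℚ) := by
  have : Function.Surjective fun o : Option Nat.Primes => o.elim infPlace primePlace := by
    intro u
    rcases eq_infPlace_or_primePlace u with rfl | ⟨p, rfl⟩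
    · exact ⟨none, rfl⟩
    · exact ⟨some p, rfl⟩
  exact this.countable

/-- The group `ℚˣ` is generated by `-1` and the primes. This reduces the product formula to these
generators. -/
theorem rat_mul_induction {P : ℚ → Prop} (hneg : P (-1)) (hprime : ∀ p : Nat.Primes, P p)
    (hmul : ∀ a b : ℚ, a ≠ 0 → b ≠ 0 → P a → P b → P (a * b))
    (hinv : ∀ a : ℚ, a ≠ 0 → P a → P a⁻¹) (q : ℚ) (hq : q ≠ 0) : P q := by
  have h1 : P 1 := by simpa using hmul (-1) (-1) (by simp) (by simp) hneg hneg
  have hnat : ∀ n : ℕ, n ≠ 0 → P n := by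
    intro n
    induction n using induction_on_primes with
    | zero => simp
    | one => simpa using h1
    | prime_mul p a hp ih =>
      intro hpa
      have ha : a ≠ 0 := right_ne_zero_of_mul hpa
      push_cast
      exact hmul _ _ (by simpa using hp.ne_zero) (by simpa using ha) (hprime ⟨p, hp⟩) (ih ha)
  have hint : ∀ n : ℤ, n ≠ 0 → P n := by
    intro n hn
    rcases Int.natAbs_eq n with h | h
    · rw [h]
      simpa using hnat n.natAbs (by simpa using hn)
    · rw [h]
      have := hmul (-1) (n.natAbs : ℚ) (by simp) (by simpa using hn) hneg
        (hnat n.natAbs (by simpa using hn))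
      simpa using this
  rw [← Rat.num_div_den q, div_eq_mul_inv]
  exact hmul _ _ (by simpa using hq) (by simp) (hint _ (by simpa using hq))
    (hinv _ (by simp) (hnat _ q.den_nz))

theorem primePlace_ne_infPlace (p : Nat.Primes) : primePlace p ≠ infPlace := by
  intro h
  have h1 := (isOverPrime_primePlace p).abv_natCast_self
  have h2 := isInfinite_infPlace (p : ℚ)
  rw [h] at h1
  have hp : (1 : ℝ) < (p : ℕ) := by exact_mod_cast p.2.one_lt
  simp only [Rat.cast_natCast] at h2
  rw [h1, abs_of_pos (by linarith)] at h2
  have := inv_lt_one_of_one_lt₀ hp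
  linarith

theorem abv_prime_eq_one (p : Nat.Primes) {u : Place ℚ} (h1 : u ≠ infPlace)
    (h2 : u ≠ primePlace p) : u.abv p = 1 := by
  rcases eq_infPlace_or_primePlace u with rfl | ⟨l, rfl⟩
  · exact absurd rfl h1
  · have hl : Fact l.1.Prime := ⟨l.2⟩
    have hp : Fact p.1.Prime := ⟨p.2⟩
    have hne : l.1 ≠ p.1 := fun h => h2 (by rw [Subtype.ext h])
    have := (isOverPrime_primePlace l).2 ((p : ℕ) : ℚ)
    rw [padicNorm.padicNorm_of_prime_of_ne hne] at this
    simpa using this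

theorem finite_abv_ne_one {q : ℚ} (hq : q ≠ 0) : {u : Place ℚ | u.abv q ≠ 1}.Finite := by
  refine rat_mul_induction (P := fun q => {u : Place ℚ | u.abv q ≠ 1}.Finite) ?_ ?_ ?_ ?_ q hq
  · simp
  · intro p
    refine (Set.toFinite {infPlace, primePlace p}).subset fun u hu => ?_
    by_contra h
    simp only [Set.mem_insert_iff, Set.mem_singleton_iff, not_or] at h
    exact hu (abv_prime_eq_one p h.1 h.2)
  · intro a b _ _ ha hb
    refine (ha.union hb).subset fun u hu => ?_
    by_contra h
    simp only [Set.mem_union, Set.mem_ofPred_eq, not_or, not_not] at h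
    exact hu (by rw [map_mul, h.1, h.2, one_mul])
  · intro a _ ha
    simpa using ha

/-- The product formula for `ℚ`. -/
theorem hasSum_log_abv {q : ℚ} (hq : q ≠ 0) :
    HasSum (fun u : Place ℚ => Real.log (u.abv q)) 0 := by
  refine rat_mul_induction (P := fun q => HasSum (fun u : Place ℚ => Real.log (u.abv q)) 0)
    ?_ ?_ ?_ ?_ q hq
  · simp [hasSum_zero]
  · intro p
    classical
    -- Only the infinite place and `p` contribute, with `log p` and `-log p`.
    have := hasSum_sum_of_ne_finset_zero (L := .unconditional _) (f := fun u : Place ℚ => Real.log (u.abv p))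
      (s := {infPlace, primePlace p}) (fun u hu => by
        simp only [Finset.mem_insert, Finset.mem_singleton, not_or] at hu
        simp only [abv_prime_eq_one p hu.1 hu.2, Real.log_one])
    rw [Finset.sum_pair (primePlace_ne_infPlace p).symm] at this
    convert this using 1
    have h1 := (isOverPrime_primePlace p).abv_natCast_self
    have h2 := isInfinite_infPlace (p : ℚ)
    simp only [Rat.cast_natCast] at h2
    rw [h1, h2, Real.log_abs, Real.log_inv]
    exact (add_neg_cancel _).symm
  · intro a b ha hb h1 h2
    have := h1.add h2
    simp only [add_zero] at this
    convert this using 2 with u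
    rw [map_mul, Real.log_mul (by simpa using ha) (by simpa using hb)]
  · intro a _ ha
    simpa using ha.neg

/-- An algebraic number is a unit at all but finitely many places. -/
theorem exists_finite_abv_eq_one [Algebra ℚ L] [Algebra.IsAlgebraic ℚ L] {α : L} (hα : α ≠ 0) :
    ∃ S : Set (Place ℚ), S.Finite ∧ ∀ y : Place L, y.res ∉ S → y.abv α = 1 := by
  -- Some nonzero integer multiple `d β` is integral, so `|β| ≤ 1` away from infinity and the primes
  -- dividing `d`. Applied to `α` and `α⁻¹`, this gives equality.
  have key : ∀ β : L, ∃ S : Set (Place ℚ), S.Finite ∧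
      ∀ y : Place L, y.res ∉ S → y.abv β ≤ 1 := by
    intro β
    have hβ : IsAlgebraic ℤ β := (IsFractionRing.isAlgebraic_iff ℤ ℚ L).2 (Algebra.IsAlgebraic.isAlgebraic β)
    obtain ⟨d, hd, hint⟩ := hβ.exists_integral_multiple
    refine ⟨insert infPlace {u : Place ℚ | u.abv (d : ℚ) ≠ 1},
      (finite_abv_ne_one (by simpa using hd)).insert _, fun y hy => ?_⟩
    simp only [Set.mem_insert_iff, Set.mem_ofPred_eq, not_or, not_not] at hy
    rcases y.isInfinite_or with h | ⟨p, h⟩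
    · exact absurd (Place.eq_of_isInfinite (Place.isInfinite_res.2 h) isInfinite_infPlace) hy.1
    · have h1 := h.abv_le_one_of_isIntegral hint
      have h2 : y.abv (d : L) = 1 := by
        rw [← hy.2, ← Place.abv_ratCast]
        simp
      rwa [zsmul_eq_mul, map_mul, h2, one_mul] at h1
  obtain ⟨S, hS, h1⟩ := key α
  obtain ⟨T, hT, h2⟩ := key α⁻¹
  refine ⟨S ∪ T, hS.union hT, fun y hy => ?_⟩
  simp only [Set.mem_union, not_or] at hy
  refine le_antisymm (h1 y hy.1) ?_
  have := h2 y hy.2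
  rw [map_inv₀] at this
  exact (inv_le_one₀ (y.abv.pos hα)).1 this

end PlaceBasics

/-! ### Transitivity of the Galois group on the places of a finite Galois extension. -/

section Transitivity

/-- A value greater than `1` pins down the exponent between equivalent absolute values. The margin
`2` leaves room for an approximation error of `1`. -/
theorem Place.exists_two_le_abv (u : Place ℚ) : ∃ q : ℚ, 2 ≤ u.abv q := by
  rcases u.isInfinite_or with h | ⟨p, h⟩
  · refine ⟨2, ?_⟩
    have := h 2
    simp only [Rat.cast_ofNat] at this
    rw [this]
    simp
  · refine ⟨(p : ℚ)⁻¹, ?_⟩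
    rw [map_inv₀, h.abv_natCast_self, inv_inv]
    exact_mod_cast h.1.two_le

variable {k : Type*} [Field k] [Algebra ℚ k]

/-- Equivalent absolute values are powers of each other. Agreement on a rational number of absolute
value at least `2` forces the exponent to be `1`. -/
theorem Place.eq_of_isEquiv {v w : Place k} (h : v.abv.IsEquiv w.abv) (hres : v.res = w.res) :
    v = w := by
  obtain ⟨c, -, hc⟩ := AbsoluteValue.isEquiv_iff_exists_rpow_eq.1 h
  obtain ⟨q, hq⟩ := v.res.exists_two_le_abv
  have h1 : v.res.abv q ^ c = v.res.abv q := by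
    conv_rhs => rw [hres]
    exact congrFun hc (algebraMap ℚ k q)
  have hc1 : c = 1 := by
    have := congrArg Real.log h1
    rw [Real.log_rpow (by linarith)] at this
    have hlog : 0 < Real.log (v.res.abv q) := Real.log_pos (by linarith)
    exact mul_right_cancel₀ hlog.ne' (this.trans (one_mul _).symm)
  ext x
  have := congrFun hc x
  simpa [hc1] using this

theorem Place.isNontrivial (v : Place k) : v.abv.IsNontrivial := by
  obtain ⟨q, hq⟩ := v.res.exists_two_le_abv
  rw [Place.res_abv] at hq
  refine ⟨algebraMap ℚ k q, fun h => ?_, fun h => ?_⟩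
  · rw [h, map_zero] at hq
    linarith
  · rw [h] at hq
    linarith

theorem Place.res_smul (σ : k ≃ₐ[ℚ] k) (v : Place k) : (σ • v).res = v.res :=
  Place.res_comap _ v

variable [FiniteDimensional ℚ k] [IsGalois ℚ k]

theorem Place.res_abv_norm (v : Place k) (x : k) :
    v.res.abv (Algebra.norm ℚ x) = ∏ σ : k ≃ₐ[ℚ] k, (σ • v).abv x := by
  rw [Place.res_abv, Algebra.norm_eq_prod_automorphisms, map_prod]
  exact Fintype.prod_equiv (Equiv.inv _) _ _ fun σ => by
    rw [smul_abv, Equiv.inv_apply, inv_inv]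

/-- The Galois group acts transitively on the places over a given place of `ℚ`. -/
theorem Place.exists_smul_eq_of_finite {v w : Place k} (h : v.res = w.res) :
    ∃ σ : k ≃ₐ[ℚ] k, σ • v = w := by
  classical
  by_contra! hne
  have hdisj : ∀ σ τ : k ≃ₐ[ℚ] k, σ • v ≠ τ • w := by
    intro σ τ hστ
    refine hne (τ⁻¹ * σ) ?_
    rw [mul_smul, hστ, inv_smul_smul]
  -- If the orbits of `v` and `w` are disjoint, weak approximation on their union yields `x` that is
  -- small on one and large on the other. The norm of `x` then has two different absolute values at
  -- the common place of `ℚ`.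
  let S : Set (Place k) :=
    Set.range (fun σ : k ≃ₐ[ℚ] k => σ • v) ∪ Set.range (fun σ : k ≃ₐ[ℚ] k => σ • w)
  have hSfin : Finite S := ((Set.finite_range _).union (Set.finite_range _)).to_subtype
  have hSres : ∀ s ∈ S, s.res = v.res := by
    rintro s (⟨σ, rfl⟩ | ⟨σ, rfl⟩)
    · exact Place.res_smul σ v
    · exact (Place.res_smul σ w).trans h.symm
  have hpair : Pairwise fun i j : S => ¬ (i.1.abv).IsEquiv (j.1.abv) := by
    intro i j hij he
    exact hij (Subtype.ext (Place.eq_of_isEquiv he ((hSres i i.2).trans (hSres j j.2).symm)))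
  have : Fintype S := Fintype.ofFinite S
  have hd := AbsoluteValue.denseRange_algebraMap_pi (v := fun s : S => s.1.abv)
    (fun s => s.1.isNontrivial) hpair
  obtain ⟨q, hq⟩ := v.res.exists_two_le_abv
  -- Approximating `0` on the orbit of `v` and `q` on that of `w` within `1` gives `|x| < 1` on the
  -- former and `|x| > 1` on the latter.
  let z : (s : S) → WithAbs s.1.abv := fun s =>
    if s.1 ∈ Set.range (fun σ : k ≃ₐ[ℚ] k => σ • v) then 0
    else WithAbs.toAbs s.1.abv (algebraMap ℚ k q)
  obtain ⟨x, hx⟩ := hd.exists_dist_lt z one_pos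
  have hx' : ∀ s : S, dist (z s) (WithAbs.toAbs s.1.abv x) < 1 := fun s =>
    ((dist_pi_lt_iff one_pos).1 hx) s
  have hv : ∀ σ : k ≃ₐ[ℚ] k, (σ • v).abv x < 1 := by
    intro σ
    have h1 := hx' ⟨σ • v, Or.inl ⟨σ, rfl⟩⟩
    have h2 : z ⟨σ • v, Or.inl ⟨σ, rfl⟩⟩ = 0 := if_pos ⟨σ, rfl⟩
    rwa [h2, dist_zero_left, WithAbs.norm_toAbs_eq] at h1
  have hw : ∀ σ : k ≃ₐ[ℚ] k, 1 < (σ • w).abv x := by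
    intro σ
    have h1 := hx' ⟨σ • w, Or.inr ⟨σ, rfl⟩⟩
    have h2 : z ⟨σ • w, Or.inr ⟨σ, rfl⟩⟩ = WithAbs.toAbs (σ • w).abv (algebraMap ℚ k q) :=
      if_neg (by rintro ⟨τ, hτ⟩; exact hdisj τ σ hτ)
    rw [h2, dist_eq_norm, ← WithAbs.toAbs_sub, WithAbs.norm_toAbs_eq] at h1
    have h3 : (σ • w).abv (algebraMap ℚ k q) = v.res.abv q := by
      rw [h, ← Place.res_smul σ w, Place.res_abv]
    have h5 := (σ • w).abv.sub_le (algebraMap ℚ k q) x 0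
    have h6 : (σ • w).abv (algebraMap ℚ k q) ≤
        (σ • w).abv (algebraMap ℚ k q - x) + (σ • w).abv x := by
      simpa using h5
    linarith
  have h1 := v.res_abv_norm x
  have h2 := w.res_abv_norm x
  rw [← h, h1] at h2
  have hx0 : x ≠ 0 := by
    rintro rfl
    have := hw 1
    rw [map_zero] at this
    linarith
  have h3 : ∏ σ : k ≃ₐ[ℚ] k, (σ • v).abv x < ∏ σ : k ≃ₐ[ℚ] k, (σ • w).abv x :=
    Finset.prod_lt_prod_of_nonempty (fun σ _ => (σ • v).abv.pos hx0)
      (fun σ _ => (hv σ).trans (hw σ)) Finset.univ_nonempty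
  exact absurd h2 h3.ne

end Transitivity

/-! ### Restriction of places from `Qbar` to finite Galois extensions. -/

section TransitivityQbar

instance (k : FiniteGaloisIntermediateField ℚ Qbar) : IsGalois ℚ k := k.isGalois

instance (k : FiniteGaloisIntermediateField ℚ Qbar) : FiniteDimensional ℚ k := k.finiteDimensional

theorem isOpen_placesOver (k : FiniteGaloisIntermediateField ℚ Qbar) (v : Place k) :
    IsOpen (placesOver k.toIntermediateField v) :=
  isOpen_generateFrom_of_mem ⟨k.toIntermediateField, inferInstance, inferInstance, v, rfl⟩

/-- The restriction of automorphisms of `Qbar` acts compatibly on places. -/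
theorem comap_smul_algebraMap (k : FiniteGaloisIntermediateField ℚ Qbar) (τ : Qbar ≃ₐ[ℚ] Qbar)
    (y : Place Qbar) : (τ • y).comap (algebraMap k Qbar) =
      AlgEquiv.restrictNormalHom k τ • y.comap (algebraMap k Qbar) := by
  ext x
  change y.abv (τ⁻¹ (algebraMap k Qbar x)) =
    y.abv (algebraMap k Qbar ((AlgEquiv.restrictNormalHom k τ)⁻¹ x))
  rw [← map_inv]
  congr 1
  exact (AlgEquiv.restrictNormal_commutes τ⁻¹ k x).symm

theorem basePlace_res (u : Place ℚ) : (basePlace u).res = u := basePlace_comap u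

end TransitivityQbar

/-! ### Countability of the fields and places, and generation of the Borel sets. -/

section Countability

instance : Countable Qbar := by
  have h := Algebraic.countable ℚ Qbar
  rw [Set.eq_univ_of_forall (s := {x : Qbar | IsAlgebraic ℚ x})
    fun x => Algebra.IsAlgebraic.isAlgebraic x] at h
  exact Set.countable_univ_iff.1 h

theorem exists_finset_adjoin_eq (E : IntermediateField ℚ Qbar) (hE : FiniteDimensional ℚ E) :
    ∃ S : Finset Qbar, IntermediateField.adjoin ℚ (S : Set Qbar) = E :=
  IntermediateField.essFiniteType_iff.1 inferInstance

instance : Countable (FiniteGaloisIntermediateField ℚ Qbar) := by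
  have h : ∀ k : FiniteGaloisIntermediateField ℚ Qbar, ∃ S : Finset Qbar,
      IntermediateField.adjoin ℚ (S : Set Qbar) = k.toIntermediateField := fun k =>
    exists_finset_adjoin_eq _ k.finiteDimensional
  choose S hS using h
  refine Function.Injective.countable (f := S) fun k l hkl => ?_
  apply FiniteGaloisIntermediateField.val_injective
  rw [← hS k, ← hS l, hkl]

variable (k : FiniteGaloisIntermediateField ℚ Qbar)

theorem exists_smul_comap_basePlace (v : Place k) :
    ∃ σ : k ≃ₐ[ℚ] k, σ • (basePlace v.res).comap (algebraMap k Qbar) = v :=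
  Place.exists_smul_eq_of_finite (by rw [Place.res_comap, basePlace_res])

instance : Countable (Place k) := by
  have : Function.Surjective fun p : Place ℚ × (k ≃ₐ[ℚ] k) =>
      p.2 • (basePlace p.1).comap (algebraMap k Qbar) := fun v => by
    obtain ⟨σ, hσ⟩ := exists_smul_comap_basePlace k v
    exact ⟨(v.res, σ), hσ⟩
  exact this.countable

theorem finite_res_eq (u : Place ℚ) : {v : Place k | v.res = u}.Finite := by
  refine (Set.finite_range fun σ : k ≃ₐ[ℚ] k =>
    σ • (basePlace u).comap (algebraMap k Qbar)).subset ?_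
  rintro v rfl
  exact exists_smul_comap_basePlace k v

/-- The subbasis of the topology of the space of places. -/
def placesOverSubbasis : Set (Set (Place Qbar)) :=
  Set.range fun p : Σ k : FiniteGaloisIntermediateField ℚ Qbar, Place k =>
    placesOver p.1.toIntermediateField p.2

theorem topology_eq_generateFrom :
    (inferInstance : TopologicalSpace (Place Qbar)) = generateFrom placesOverSubbasis := by
  refine congrArg generateFrom ?_
  ext U
  constructor
  · rintro ⟨k, hk, hgal, v, rfl⟩
    exact ⟨⟨@FiniteGaloisIntermediateField.mk _ _ _ _ _ k hk hgal, v⟩, rfl⟩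
  · rintro ⟨⟨k, v⟩, rfl⟩
    exact ⟨k.toIntermediateField, inferInstance, inferInstance, v, rfl⟩

/-- Second countability makes the subbasis generate the Borel `σ`-algebra, so measurability can be
tested on the sets `Y(k, v)`. -/
instance : SecondCountableTopology (Place Qbar) :=
  ⟨⟨placesOverSubbasis, Set.countable_range _, topology_eq_generateFrom⟩⟩

theorem measurableSpace_eq_generateFrom :
    (inferInstance : MeasurableSpace (Place Qbar)) =
      MeasurableSpace.generateFrom placesOverSubbasis :=
  borel_eq_generateFrom_of_subbasis topology_eq_generateFrom

theorem measurableSet_placesOver (v : Place k) :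
    MeasurableSet (placesOver k.toIntermediateField v) :=
  (isOpen_placesOver k v).measurableSet

end Countability

/-! ### Joint measurability of the Galois action. -/

section Action

theorem measurable_of_eq_generateFrom {α β : Type*} [MeasurableSpace α] {m : MeasurableSpace β}
    {S : Set (Set β)} (hm : m = MeasurableSpace.generateFrom S) {f : α → β}
    (hf : ∀ s ∈ S, MeasurableSet (f ⁻¹' s)) : Measurable f := by
  subst hm
  exact measurable_generateFrom hf

/-- Whether `τ⁻¹ y` lies over `v` depends only on the restrictions of `τ` and `y` to `k`, so the
preimage of `Y(k, v)` is a finite union of measurable rectangles. -/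
theorem measurable_inv_smul :
    Measurable fun p : (Qbar ≃ₐ[ℚ] Qbar) × Place Qbar => p.1⁻¹ • p.2 := by
  refine measurable_of_eq_generateFrom measurableSpace_eq_generateFrom ?_
  rintro _ ⟨⟨k, v⟩, rfl⟩
  have hset : (fun p : (Qbar ≃ₐ[ℚ] Qbar) × Place Qbar => p.1⁻¹ • p.2) ⁻¹'
      placesOver k.toIntermediateField v = ⋃ σ : k ≃ₐ[ℚ] k,
        {τ | AlgEquiv.restrictNormalHom k τ = σ} ×ˢ placesOver k.toIntermediateField (σ • v) := by
    ext ⟨τ, y⟩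
    simp only [Set.mem_preimage, Set.mem_iUnion, Set.mem_prod, Set.mem_ofPred_eq, exists_eq_left',
      placesOver]
    rw [comap_smul_algebraMap, map_inv, inv_smul_eq_iff]
  rw [hset]
  refine MeasurableSet.iUnion fun σ => MeasurableSet.prod ?_ (measurableSet_placesOver k _)
  exact ((isOpen_discrete {σ}).preimage
    (InfiniteGalois.restrictNormalHom_continuous k.toIntermediateField)).measurableSet

variable (F : Type*) [Field F] [Algebra F Qbar]

/-- An automorphism of `Qbar` over a subfield, regarded as an automorphism over `ℚ`. -/
def toRatAut : (Qbar ≃ₐ[F] Qbar) →* (Qbar ≃ₐ[ℚ] Qbar) where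
  toFun τ := AlgEquiv.ofRingEquiv (f := τ.toRingEquiv) fun q => by simp
  map_one' := rfl
  map_mul' _ _ := rfl

theorem toRatAut_smul (τ : Qbar ≃ₐ[F] Qbar) (y : Place Qbar) : toRatAut F τ • y = τ • y := rfl

theorem map_smul_placeMeasure (τ : Qbar ≃ₐ[F] Qbar) :
    placeMeasure.map (fun y => τ • y) = placeMeasure :=
  placeMeasure_map_smul (toRatAut F τ)

variable [IsGalois F Qbar]

/-- A basic neighbourhood of `1` fixes a field generated by a finite set, and stabilizers of
algebraic elements are open in `Aut(Qbar/F)` too. -/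
theorem continuous_toRatAut : Continuous (toRatAut F) := by
  refine continuous_of_continuousAt_one _ ?_
  rw [ContinuousAt, map_one]
  intro U hU
  obtain ⟨E, hE, hEU⟩ := (krullTopology_mem_nhds_one_iff ℚ Qbar U).1 hU
  obtain ⟨S, rfl⟩ := exists_finset_adjoin_eq E hE
  have hopen : IsOpen (⋂ x ∈ S, (MulAction.stabilizer (Qbar ≃ₐ[F] Qbar) x :
      Set (Qbar ≃ₐ[F] Qbar))) :=
    isOpen_biInter_finset fun x _ => stabilizer_isOpen_of_isIntegral x
  rw [Filter.mem_map]
  refine Filter.mem_of_superset (hopen.mem_nhds (Set.mem_iInter₂.2 fun x _ => one_smul _ x))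
    fun τ hτ => hEU ?_
  have := (IntermediateField.forall_mem_adjoin_smul_eq_self_iff ℚ (S := (S : Set Qbar))
    (toRatAut F τ)).2 fun x hx => Set.mem_iInter₂.1 hτ x hx
  exact (IntermediateField.mem_fixingSubgroup_iff _ _).2 this

theorem measurable_inv_smul_prod :
    Measurable fun p : (Qbar ≃ₐ[F] Qbar) × Place Qbar => p.1⁻¹ • p.2 := by
  have h : Measurable fun p : (Qbar ≃ₐ[F] Qbar) × Place Qbar => (toRatAut F p.1, p.2) :=
    ((continuous_toRatAut F).measurable.comp measurable_fst).prodMk measurable_snd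
  have heq : (fun p : (Qbar ≃ₐ[F] Qbar) × Place Qbar => p.1⁻¹ • p.2) =
      (fun p : (Qbar ≃ₐ[ℚ] Qbar) × Place Qbar => p.1⁻¹ • p.2) ∘
        fun p : (Qbar ≃ₐ[F] Qbar) × Place Qbar => (toRatAut F p.1, p.2) := by
    funext p
    change _ = (toRatAut F p.1)⁻¹ • p.2
    rw [← map_inv, toRatAut_smul]
  rw [heq]
  exact measurable_inv_smul.comp h

/-- A right translate is again a Haar probability measure, and such a measure is unique. -/
instance : (haarAut F).IsMulRightInvariant where
  map_mul_right_eq_self g := by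
    have := Measure.isHaarMeasure_map_mul_right (haarAut F) g
    have : IsProbabilityMeasure ((haarAut F).map (· * g)) :=
      Measure.isProbabilityMeasure_map (measurable_mul_const g).aemeasurable
    exact Measure.isHaarMeasure_eq_of_isProbabilityMeasure _ _

end Action

/-! ### Fibres over the places of `ℚ`. -/

instance : SFinite placeMeasure := by
  unfold placeMeasure
  infer_instance

/-- The set of places of `Qbar` over a given place of `ℚ`. -/
def fiber (u : Place ℚ) : Set (Place Qbar) := {y | y.res = u}

theorem placeMeasure_fiber (u : Place ℚ) : placeMeasure (fiber u) = 1 := placeMeasure_over u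

theorem biUnion_placesOver_eq_fiber (k : FiniteGaloisIntermediateField ℚ Qbar) (u : Place ℚ) :
    ⋃ v ∈ {v : Place k | v.res = u}, placesOver k.toIntermediateField v = fiber u := by
  ext y
  simp only [Set.mem_iUnion, Set.mem_ofPred_eq, exists_prop, placesOver, fiber]
  constructor
  · rintro ⟨v, rfl, rfl⟩
    exact (Place.res_comap _ _).symm
  · rintro rfl
    exact ⟨_, Place.res_comap _ _, rfl⟩

theorem placesOver_subset_fiber (k : FiniteGaloisIntermediateField ℚ Qbar) (v : Place k) :
    placesOver k.toIntermediateField v ⊆ fiber v.res := by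
  rw [← biUnion_placesOver_eq_fiber k]
  exact Set.subset_biUnion_of_mem (u := fun v => placesOver k.toIntermediateField v) rfl

theorem measurableSet_fiber (u : Place ℚ) : MeasurableSet (fiber u) := by
  rw [← biUnion_placesOver_eq_fiber ⊥ u]
  exact MeasurableSet.biUnion (Set.to_countable _) fun v _ => measurableSet_placesOver _ v

theorem placeMeasure_placesOver_lt_top (k : FiniteGaloisIntermediateField ℚ Qbar) (v : Place k) :
    placeMeasure (placesOver k.toIntermediateField v) < ⊤ :=
  (measure_mono (placesOver_subset_fiber k v)).trans_lt (by simp [placeMeasure_fiber])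

/-! ### Averages of `log |τ α|` over the Galois group. -/

section Average

variable (F : Type*) [Field F] [Algebra F Qbar] [IsGalois F Qbar]

/-- The map `τ ↦ τ α` is constant on the cosets of the open stabilizer of `α`, so no assumption on
`φ` is needed. -/
theorem continuous_apply_aut {E : Type*} [TopologicalSpace E] (φ : Qbar → E) (α : Qbar) :
    Continuous fun τ : Qbar ≃ₐ[F] Qbar => φ (τ α) := by
  refine IsLocallyConstant.continuous ((IsLocallyConstant.iff_exists_open _).2 fun τ => ?_)
  refine ⟨(fun σ => τ⁻¹ * σ) ⁻¹' (MulAction.stabilizer (Qbar ≃ₐ[F] Qbar) α),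
    (stabilizer_isOpen_of_isIntegral α).preimage (continuous_const_mul _), by simp, ?_⟩
  intro σ hσ
  have h : τ⁻¹ (σ α) = α := hσ
  have h2 : σ α = τ α := by
    conv_rhs => rw [← h]
    exact (τ.apply_symm_apply (σ α)).symm
  simp only [h2]

theorem integrable_of_continuous {f : (Qbar ≃ₐ[F] Qbar) → ℝ} (hf : Continuous f) :
    Integrable f (haarAut F) :=
  hf.integrable_of_hasCompactSupport (HasCompactSupport.of_compactSpace f)

theorem finite_orbit (α : Qbar) : (MulAction.orbit (Qbar ≃ₐ[F] Qbar) α).Finite := by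
  refine ((minpoly F α).rootSet_finite Qbar).subset ?_
  rintro _ ⟨τ, rfl⟩
  rw [Polynomial.mem_rootSet]
  refine ⟨minpoly.ne_zero (Algebra.IsIntegral.isIntegral α), ?_⟩
  change (Polynomial.aeval (τ α)) (minpoly F α) = 0
  rw [Polynomial.aeval_algHom_apply τ α, minpoly.aeval, map_zero]

/-- The average over the Galois group of the logarithms of the absolute values of the conjugates
of `α` is a rational multiple of the logarithm of the absolute value of an element of the base
field. -/
theorem exists_integral_log_abv_eq {α : Qbar} (hα : α ≠ 0) :
    ∃ n : ℕ, n ≠ 0 ∧ ∃ β : F, β ≠ 0 ∧ ∀ y : Place Qbar,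
      ∫ τ : Qbar ≃ₐ[F] Qbar, Real.log (y.abv (τ α)) ∂haarAut F =
        (n : ℝ)⁻¹ * Real.log (y.abv (algebraMap F Qbar β)) := by
  classical
  let O : Finset Qbar := (finite_orbit F α).toFinset
  have hO : ∀ γ, γ ∈ O ↔ ∃ σ : Qbar ≃ₐ[F] Qbar, σ α = γ := fun γ =>
    (finite_orbit F α).mem_toFinset
  have hαO : α ∈ O := (hO α).2 ⟨1, rfl⟩
  have hne : ∀ γ ∈ O, γ ≠ 0 := by
    intro γ hγ
    obtain ⟨σ, rfl⟩ := (hO γ).1 hγ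
    simpa using hα
  have hfix : ∀ τ : Qbar ≃ₐ[F] Qbar, ∏ γ ∈ O, τ γ = ∏ γ ∈ O, γ := by
    intro τ
    refine Finset.prod_nbij' (fun γ => τ γ) (fun γ => τ.symm γ) ?_ ?_ ?_ ?_ ?_
    · intro γ hγ
      obtain ⟨σ, rfl⟩ := (hO γ).1 hγ
      exact (hO _).2 ⟨τ * σ, rfl⟩
    · intro γ hγ
      obtain ⟨σ, rfl⟩ := (hO γ).1 hγ
      exact (hO _).2 ⟨τ.symm * σ, rfl⟩
    · simp
    · simp
    · simp
  -- The product of all conjugates of `α` is Galois invariant, hence lies in `F`. The integer `n` is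
  -- the number of conjugates.
  obtain ⟨β, hβ⟩ := (InfiniteGalois.mem_range_algebraMap_iff_fixed (k := F) (∏ γ ∈ O, γ)).2
    (fun τ => by rw [map_prod]; exact hfix τ)
  have hprod : ∏ γ ∈ O, γ ≠ 0 := Finset.prod_ne_zero_iff.2 hne
  refine ⟨O.card, Finset.card_ne_zero_of_mem hαO, β, ?_, fun y => ?_⟩
  · rintro rfl
    exact hprod (hβ.symm.trans (map_zero _))
  have hint : ∀ γ : Qbar, Integrable (fun τ : Qbar ≃ₐ[F] Qbar => Real.log (y.abv (τ γ)))
      (haarAut F) := fun γ =>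
    integrable_of_continuous F (continuous_apply_aut F (fun x => Real.log (y.abv x)) γ)
  -- By right invariance every conjugate has the same average, so `n` times that average is the
  -- average of the constant `log |β|`.
  have horb : ∀ γ ∈ O, ∫ τ : Qbar ≃ₐ[F] Qbar, Real.log (y.abv (τ γ)) ∂haarAut F =
      ∫ τ : Qbar ≃ₐ[F] Qbar, Real.log (y.abv (τ α)) ∂haarAut F := by
    intro γ hγ
    obtain ⟨σ, rfl⟩ := (hO γ).1 hγ
    exact integral_mul_right_eq_self (μ := haarAut F)
      (fun τ : Qbar ≃ₐ[F] Qbar => Real.log (y.abv (τ α))) σ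
  have hsum : ∑ γ ∈ O, ∫ τ : Qbar ≃ₐ[F] Qbar, Real.log (y.abv (τ γ)) ∂haarAut F =
      Real.log (y.abv (∏ γ ∈ O, γ)) := by
    rw [← integral_finsetSum _ fun γ _ => hint γ]
    have : ∀ τ : Qbar ≃ₐ[F] Qbar, ∑ γ ∈ O, Real.log (y.abv (τ γ)) =
        Real.log (y.abv (∏ γ ∈ O, γ)) := by
      intro τ
      rw [← hfix τ, map_prod, Real.log_prod]
      intro γ hγ
      simpa using hne γ hγ
    simp [this]
  rw [Finset.sum_congr rfl horb, Finset.sum_const, nsmul_eq_mul, ← hβ] at hsum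
  rw [← hsum, inv_mul_cancel_left₀]
  exact_mod_cast Finset.card_ne_zero_of_mem hαO

instance : (haarAut F).IsInvInvariant where
  inv_eq_self := by
    have : IsProbabilityMeasure (haarAut F).inv :=
      Measure.isProbabilityMeasure_map measurable_inv.aemeasurable
    have : (haarAut F).inv.IsOpenPosMeasure :=
      continuous_inv.isOpenPosMeasure_map inv_surjective
    have : (haarAut F).inv.IsHaarMeasure := { }
    exact Measure.isHaarMeasure_eq_of_isProbabilityMeasure _ _

end Average

/-! ### The functions `f_α` as elements of `X`. -/

section LogAbs

/-- The value at `y` depends only on the restriction of `y` to the Galois closure of `ℚ(α)`, so the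
function is locally constant. -/
theorem continuous_logAbs (α : Qbar) : Continuous (logAbs α) := by
  refine IsLocallyConstant.continuous ((IsLocallyConstant.iff_exists_open _).2 fun y => ?_)
  refine ⟨placesOver (FiniteGaloisIntermediateField.adjoin ℚ {α}).toIntermediateField
    (y.comap (algebraMap _ Qbar)), isOpen_placesOver _ _, rfl, fun z hz => ?_⟩
  have h := congrArg (fun u : Place (FiniteGaloisIntermediateField.adjoin ℚ {α}) => u.abv
    ⟨α, FiniteGaloisIntermediateField.subset_adjoin ℚ {α} rfl⟩) hz
  exact congrArg Real.log h

variable {α : Qbar}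

theorem logAbs_smul {F : Type*} [Field F] [Algebra F Qbar] (τ : Qbar ≃ₐ[F] Qbar) (y : Place Qbar) :
    logAbs α (τ⁻¹ • y) = Real.log (y.abv (τ α)) := by
  rw [logAbs, smul_abv, inv_inv]

/-- Inversion invariance of Haar measure turns `|τ⁻¹ α|` into `|τ α|`. Taking `g` to be the norm
serves integrability, and the identity serves the integral. -/
theorem integral_logAbs_orbit (u : Place ℚ) (g : ℝ → ℝ) (hg : Continuous g) :
    ∫ y, g (logAbs α y) ∂((haarAut ℚ).map fun τ : Qbar ≃ₐ[ℚ] Qbar => τ • basePlace u) =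
      ∫ τ : Qbar ≃ₐ[ℚ] Qbar, g (Real.log ((basePlace u).abv (τ α))) ∂haarAut ℚ := by
  rw [integral_map (continuous_orbit _).measurable.aemeasurable
    (Continuous.aestronglyMeasurable (hg.comp' (continuous_logAbs α)))]
  rw [← integral_inv_eq_self]
  simp only [logAbs_smul]

/-- On each fibre the integrand is a continuous function on a compact group, and `α` is a unit on
all but finitely many fibres. -/
theorem integrable_logAbs (hα : α ≠ 0) : Integrable (logAbs α) placeMeasure := by
  refine integrable_sum_measure (fun u => ?_) ?_
  · rw [integrable_map_measure (continuous_logAbs α).aestronglyMeasurable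
      (continuous_orbit _).measurable.aemeasurable]
    exact integrable_of_continuous ℚ ((continuous_logAbs α).comp (continuous_orbit _))
  · obtain ⟨S, hS, h⟩ := exists_finite_abv_eq_one hα
    refine summable_of_hasFiniteSupport (hS.subset fun u hu => ?_)
    by_contra huS
    refine hu ?_
    dsimp only
    rw [integral_logAbs_orbit u (fun x => ‖x‖) continuous_norm]
    have : ∀ τ : Qbar ≃ₐ[ℚ] Qbar, (basePlace u).abv (τ α) = 1 := by
      intro τ
      have := h (τ⁻¹ • basePlace u) (by rwa [Place.res_smul, basePlace_res])
      rwa [smul_abv, inv_inv] at this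
    simp [this]

/-- The fibre over `u` contributes `n⁻¹ log |β|_u` with one `β ∈ ℚˣ` for all `u`; the product
formula for `ℚ` makes the sum vanish. -/
theorem integral_logAbs (hα : α ≠ 0) : ∫ y, logAbs α y ∂placeMeasure = 0 := by
  have h := hasSum_integral_measure (integrable_logAbs hα)
  obtain ⟨n, -, β, hβ, hn⟩ := exists_integral_log_abv_eq ℚ hα
  have h2 := (hasSum_log_abv hβ).mul_left (n : ℝ)⁻¹
  rw [mul_zero] at h2
  refine h.unique ?_
  convert! h2 using 2 with u
  have := integral_logAbs_orbit (α := α) u id continuous_id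
  simp only [id] at this
  rw [this, hn, ← Place.res_abv, basePlace_res]

/-- The element `f_α` of `X`. -/
def logElem (α : Qbar) (hα : α ≠ 0) : X :=
  ⟨(integrable_logAbs hα).toL1 (logAbs α), by
    change ∫ y, (integrable_logAbs hα).toL1 (logAbs α) y ∂placeMeasure = 0
    rw [integral_congr_ae (integrable_logAbs hα).coeFn_toL1, integral_logAbs hα]⟩

theorem coeFn_logElem (hα : α ≠ 0) :
    ((logElem α hα : L1) : Place Qbar → ℝ) =ᵐ[placeMeasure] logAbs α :=
  (integrable_logAbs hα).coeFn_toL1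

theorem X.ext_ae {F G : X} (h : ((F : L1) : Place Qbar → ℝ) =ᵐ[placeMeasure] (G : L1)) : F = G :=
  Subtype.ext (Lp.ext h)

theorem mem_FK_iff {K : IntermediateField ℚ Qbar} {F : X} :
    F ∈ FK K ↔ ∃ α : Qbar, ∃ hα : α ≠ 0, α ∈ K ∧ F = logElem α hα := by
  constructor
  · rintro ⟨α, hK, hα, h⟩
    exact ⟨α, hα, hK, X.ext_ae (h.trans (coeFn_logElem hα).symm)⟩
  · rintro ⟨α, hα, hK, rfl⟩
    exact ⟨α, hK, hα, coeFn_logElem hα⟩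

end LogAbs

/-! ### The averaging operator on `L¹` and on `X`. -/

section Averaging

variable (F : Type*) [Field F] [Algebra F Qbar] [IsGalois F Qbar]

/-- For each `τ` the map `y ↦ τ⁻¹ y` preserves `λ`, so the skew product `(τ, y) ↦ (τ, τ⁻¹ y)`
preserves the product measure. Projection to `Y` gives `λ` because the group has mass `1`. -/
theorem measurePreserving_inv_smul :
    MeasurePreserving (fun p : Place Qbar × (Qbar ≃ₐ[F] Qbar) => p.2⁻¹ • p.1)
      (placeMeasure.prod (haarAut F)) placeMeasure := by
  have h : MeasurePreserving
      (fun p : (Qbar ≃ₐ[F] Qbar) × Place Qbar => (p.1, p.1⁻¹ • p.2))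
      ((haarAut F).prod placeMeasure) ((haarAut F).prod placeMeasure) :=
    (MeasurePreserving.id (haarAut F)).skew_product (μc := placeMeasure)
    (μd := placeMeasure) (g := fun τ y => τ⁻¹ • y) (measurable_inv_smul_prod F)
    (Filter.Eventually.of_forall fun τ => map_smul_placeMeasure F τ⁻¹)
  have h2 : MeasurePreserving (fun p : (Qbar ≃ₐ[F] Qbar) × Place Qbar => p.1⁻¹ • p.2)
      ((haarAut F).prod placeMeasure) placeMeasure :=
    haveI h1 := (measurePreserving_snd (μ := haarAut F) (ν := placeMeasure)).comp h
    h1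
  have h3 := h2.comp (Measure.measurePreserving_swap (μ := placeMeasure) (ν := haarAut F))
  exact h3

/-- The average of a function on the space of places over the Galois group of `Qbar/F`. -/
def average (f : Place Qbar → ℝ) (y : Place Qbar) : ℝ :=
  ∫ τ : Qbar ≃ₐ[F] Qbar, f (τ⁻¹ • y) ∂haarAut F

variable {F}

/-- The exceptional null set pulls back to a null set of the product, almost all of whose slices are
null. Hence averaging is well defined on `L¹` classes. -/
theorem average_congr_ae {f g : Place Qbar → ℝ} (h : f =ᵐ[placeMeasure] g) :
    average F f =ᵐ[placeMeasure] average F g := by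
  filter_upwards [Measure.ae_ae_of_ae_prod
    ((measurePreserving_inv_smul F).quasiMeasurePreserving.ae_eq_comp h)] with y hy
  exact integral_congr_ae hy

variable {f g : Place Qbar → ℝ} (hf : Integrable f placeMeasure)

include hf

theorem integrable_comp_inv_smul :
    Integrable (fun p : Place Qbar × (Qbar ≃ₐ[F] Qbar) => f (p.2⁻¹ • p.1))
      (placeMeasure.prod (haarAut F)) :=
  (measurePreserving_inv_smul F).integrable_comp_of_integrable hf

theorem ae_integrable_inv_smul : ∀ᵐ y ∂placeMeasure,
    Integrable (fun τ : Qbar ≃ₐ[F] Qbar => f (τ⁻¹ • y)) (haarAut F) :=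
  (integrable_comp_inv_smul hf).prod_right_ae

theorem integrable_average : Integrable (average F f) placeMeasure :=
  (integrable_comp_inv_smul hf).integral_prod_left

theorem integral_average : ∫ y, average F f y ∂placeMeasure = ∫ y, f y ∂placeMeasure := by
  have h1 := integral_prod _ (integrable_comp_inv_smul (F := F) hf)
  have h2 := (measurePreserving_inv_smul F).map_eq
  have h3 := integral_map (f := f) (measurePreserving_inv_smul F).measurable.aemeasurable
    (by rw [h2]; exact hf.aestronglyMeasurable)
  rw [h2] at h3
  rw [h3]
  exact h1.symm

theorem integral_norm_average_le :
    ∫ y, ‖average F f y‖ ∂placeMeasure ≤ ∫ y, ‖f y‖ ∂placeMeasure := by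
  rw [← integral_average (F := F) hf.norm]
  refine integral_mono (integrable_average hf).norm (integrable_average hf.norm) fun y => ?_
  exact norm_integral_le_integral_norm _

theorem average_add_ae (hg : Integrable g placeMeasure) :
    average F (f + g) =ᵐ[placeMeasure] average F f + average F g := by
  filter_upwards [ae_integrable_inv_smul (F := F) hf, ae_integrable_inv_smul (F := F) hg]
    with y h1 h2
  exact integral_add h1 h2

omit hf

variable (F)

/-- Averaging over the Galois group of `Qbar/F` as an operator on `L¹`. -/
def averageL1 : L1 →L[ℝ] L1 :=
  LinearMap.mkContinuous
    { toFun := fun G => (integrable_average (F := F) (L1.integrable_coeFn G)).toL1 (average F G)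
      map_add' := fun G H => by
        refine Lp.ext ?_
        refine (Integrable.coeFn_toL1 _).trans ?_
        refine (average_congr_ae (Lp.coeFn_add G H)).trans ?_
        refine (average_add_ae (L1.integrable_coeFn G) (L1.integrable_coeFn H)).trans ?_
        refine Filter.EventuallyEq.trans ?_ (Lp.coeFn_add _ _).symm
        exact (Integrable.coeFn_toL1 _).symm.add (Integrable.coeFn_toL1 _).symm
      map_smul' := fun c G => by
        refine Lp.ext ?_
        refine (Integrable.coeFn_toL1 _).trans ?_
        refine (average_congr_ae (Lp.coeFn_smul c G)).trans ?_
        refine Filter.EventuallyEq.trans ?_ (Lp.coeFn_smul _ _).symm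
        refine Filter.EventuallyEq.trans ?_
          ((Integrable.coeFn_toL1 (integrable_average (L1.integrable_coeFn G))).symm.const_smul c)
        refine Filter.Eventually.of_forall fun y => ?_
        exact integral_smul c _ } 1 fun G => by
    rw [one_mul, L1.norm_eq_integral_norm, L1.norm_eq_integral_norm]
    refine (integral_congr_ae ?_).trans_le (integral_norm_average_le (F := F)
      (L1.integrable_coeFn G))
    filter_upwards [Integrable.coeFn_toL1 (integrable_average (F := F) (L1.integrable_coeFn G))]
      with y hy
    exact congrArg norm hy

theorem coeFn_averageL1 (G : L1) : averageL1 F G =ᵐ[placeMeasure] average F G :=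
  Integrable.coeFn_toL1 (integrable_average (L1.integrable_coeFn G))

/-- Averaging over the Galois group of `Qbar/F` as an operator on `X`. -/
def averageX : X →L[ℝ] X :=
  ((averageL1 F).comp X.subtypeL).codRestrict X fun G => by
    change ∫ y, averageL1 F G y ∂placeMeasure = 0
    rw [integral_congr_ae (coeFn_averageL1 F G), integral_average (L1.integrable_coeFn _)]
    exact G.2

theorem coeFn_averageX (G : X) :
    ((averageX F G : L1) : Place Qbar → ℝ) =ᵐ[placeMeasure] average F (G : L1) :=
  coeFn_averageL1 F G

theorem average_logAbs {α : Qbar} (y : Place Qbar) :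
    average F (logAbs α) y = ∫ τ : Qbar ≃ₐ[F] Qbar, Real.log (y.abv (τ α)) ∂haarAut F :=
  integral_congr_ae (Filter.Eventually.of_forall fun τ => logAbs_smul τ y)

theorem averageX_logElem {α : Qbar} (hα : α ≠ 0) : ∃ n : ℕ, n ≠ 0 ∧ ∃ β : F, ∃ hβ : β ≠ 0,
    averageX F (logElem α hα) = (n : ℝ)⁻¹ • logElem (algebraMap F Qbar β) (by simpa using hβ) := by
  obtain ⟨n, hn, β, hβ, h⟩ := exists_integral_log_abv_eq F hα
  refine ⟨n, hn, β, hβ, X.ext_ae ?_⟩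
  refine (coeFn_averageX F _).trans ?_
  refine (average_congr_ae (coeFn_logElem hα)).trans ?_
  refine Filter.EventuallyEq.trans ?_ (Lp.coeFn_smul _ _).symm
  refine Filter.EventuallyEq.trans ?_
    ((coeFn_logElem (α := algebraMap F Qbar β) (by simpa using hβ)).symm.const_smul _)
  exact Filter.Eventually.of_forall fun y => (average_logAbs F y).trans (h y)

theorem averageX_logElem_algebraMap {β : F} (hβ : algebraMap F Qbar β ≠ 0) :
    averageX F (logElem (algebraMap F Qbar β) hβ) = logElem (algebraMap F Qbar β) hβ := by
  refine X.ext_ae ?_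
  refine (coeFn_averageX F _).trans ?_
  refine (average_congr_ae (coeFn_logElem hβ)).trans ?_
  refine Filter.EventuallyEq.trans ?_ (coeFn_logElem hβ).symm
  refine Filter.Eventually.of_forall fun y => ?_
  rw [average_logAbs]
  simp [logAbs]

end Averaging

/-! ### The averaging operator as a projection onto `X_K`. -/

section Image

variable (K : IntermediateField ℚ Qbar)

theorem isAveraging_averageX : IsAveraging K (averageX K) := fun G => by
  filter_upwards [coeFn_averageX K G, ae_integrable_inv_smul (F := K) (L1.integrable_coeFn (G : L1))]
    with y h1 h2
  exact ⟨h2, h1⟩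

variable {K}

theorem IsAveraging.eq_averageX {V : X → X} (hV : IsAveraging K V) : V = averageX K := by
  funext G
  refine X.ext_ae ?_
  filter_upwards [hV G, isAveraging_averageX K G] with y h1 h2
  exact h1.2.trans h2.2.symm

theorem averageX_eq_self_of_mem_XK {G : X} (hG : G ∈ XK K) : averageX K G = G := by
  have hcl : IsClosed {G : X | averageX K G = G} :=
    isClosed_eq (averageX K).continuous continuous_id
  refine closure_minimal (fun G hG => ?_) hcl hG
  refine Submodule.span_induction (p := fun G _ => averageX K G = G) ?_ ?_ ?_ ?_ hG
  · intro H hH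
    obtain ⟨α, hα, hαK, rfl⟩ := mem_FK_iff.1 hH
    exact averageX_logElem_algebraMap K (β := ⟨α, hαK⟩) hα
  · exact map_zero _
  · intro H J _ _ h1 h2
    rw [map_add, h1, h2]
  · intro q H _ h
    rw [map_rat_smul (averageX K) q H, h]

theorem logElem_mem_XK {α : Qbar} (hα : α ≠ 0) (hαK : α ∈ K) : logElem α hα ∈ XK K :=
  subset_closure (Submodule.subset_span (mem_FK_iff.2 ⟨α, hα, hαK, rfl⟩))

/-- Density reduces the claim to `G = f_α`, whose average is a rational multiple of some `f_β` with
`β ∈ K`. -/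
theorem averageX_mem_XK (htop : XK ⊤ = ⊤) (G : X) : averageX K G ∈ XK K := by
  have hcl : IsClosed {G : X | averageX K G ∈ XK K} :=
    (isClosed_closure (s := (DK K : Set X))).preimage (averageX K).continuous
  have hG : G ∈ XK ⊤ := htop ▸ Submodule.mem_top
  refine closure_minimal (fun G hG => ?_) hcl hG
  refine Submodule.span_induction (p := fun G _ => averageX K G ∈ XK K) ?_ ?_ ?_ ?_ hG
  · intro H hH
    obtain ⟨α, hα, -, rfl⟩ := mem_FK_iff.1 hH
    obtain ⟨n, -, β, hβ, h⟩ := averageX_logElem K hα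
    rw [h]
    exact (XK K).smul_mem _ (logElem_mem_XK _ β.2)
  · rw [map_zero]
    exact (XK K).zero_mem
  · intro H J _ _ h1 h2
    rw [map_add]
    exact (XK K).add_mem h1 h2
  · intro q H _ h
    rw [map_rat_smul (averageX K) q H, ← Rat.cast_smul_eq_qsmul ℝ]
    exact (XK K).smul_mem _ h

end Image

/-! ### Indicator functions in a closed subspace of `L¹`. -/

section IndicatorMem

variable {Ω : Type*} [MeasurableSpace Ω] {μ : Measure Ω}

/-- The indicator function of `s` is integrable and its class belongs to the subspace `M`. -/
def IndicatorMem (M : Submodule ℝ (Lp ℝ 1 μ)) (s : Set Ω) : Prop :=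
  ∃ (hs : MeasurableSet s) (h : μ s ≠ ⊤), indicatorConstLp 1 hs h (1 : ℝ) ∈ M

variable {M : Submodule ℝ (Lp ℝ 1 μ)} {s t : Set Ω}

theorem IndicatorMem.empty : IndicatorMem M (∅ : Set Ω) :=
  ⟨MeasurableSet.empty, by simp, by rw [indicatorConstLp_empty]; exact M.zero_mem⟩

theorem IndicatorMem.union (hs : IndicatorMem M s) (ht : IndicatorMem M t) (h : Disjoint s t) :
    IndicatorMem M (s ∪ t) := by
  obtain ⟨hs1, hs2, hs3⟩ := hs
  obtain ⟨ht1, ht2, ht3⟩ := ht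
  refine ⟨hs1.union ht1, by finiteness, ?_⟩
  rw [indicatorConstLp_disjoint_union hs1 ht1 hs2 ht2 h]
  exact M.add_mem hs3 ht3

theorem IndicatorMem.diff (hs : IndicatorMem M s) (ht : IndicatorMem M t) (h : s ⊆ t) :
    IndicatorMem M (t \ s) := by
  obtain ⟨hs1, hs2, hs3⟩ := hs
  obtain ⟨ht1, ht2, ht3⟩ := ht
  have hfin : μ (t \ s) ≠ ⊤ := measure_ne_top_of_subset Set.sdiff_subset ht2
  refine ⟨ht1.diff hs1, hfin, ?_⟩
  have h1 := indicatorConstLp_disjoint_union (p := 1) (ht1.diff hs1) hs1 hfin hs2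
    Set.disjoint_sdiff_left (1 : ℝ)
  simp only [Set.sdiff_union_of_subset h] at h1
  rw [h1] at ht3
  exact (M.add_mem_iff_left hs3).1 ht3

theorem IndicatorMem.biUnion_finset {ι : Type*} {s : ι → Set Ω} (F : Finset ι)
    (hs : ∀ i ∈ F, IndicatorMem M (s i)) (hd : Pairwise (Function.onFun Disjoint s)) :
    IndicatorMem M (⋃ i ∈ F, s i) := by
  classical
  induction F using Finset.induction_on with
  | empty => simpa using IndicatorMem.empty
  | insert i F hi ih =>
    rw [Finset.set_biUnion_insert]
    refine (hs i (Finset.mem_insert_self i F)).union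
      (ih fun j hj => hs j (Finset.mem_insert_of_mem hj)) ?_
    refine Set.disjoint_iUnion₂_right.2 fun j hj => hd ?_
    rintro rfl
    exact hi hj

/-- Since the union has finite measure, the finite partial unions differ from it by sets of measure
tending to `0`, so their indicators converge in `L¹`. -/
theorem IndicatorMem.iUnion (hM : IsClosed (M : Set (Lp ℝ 1 μ))) {ι : Type*} [Countable ι]
    {s : ι → Set Ω} (hs : ∀ i, IndicatorMem M (s i)) (hd : Pairwise (Function.onFun Disjoint s))
    (hfin : μ (⋃ i, s i) ≠ ⊤) : IndicatorMem M (⋃ i, s i) := by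
  have hF : ∀ F : Finset ι, IndicatorMem M (⋃ i ∈ F, s i) := fun F =>
    IndicatorMem.biUnion_finset F (fun i _ => hs i) hd
  have hmono : Monotone fun F : Finset ι => ⋃ i ∈ F, s i := fun F G hFG =>
    Set.biUnion_mono hFG fun _ _ => le_rfl
  have hU : ⋃ F : Finset ι, ⋃ i ∈ F, s i = ⋃ i, s i := (Set.iUnion_eq_iUnion_finset s).symm
  have ht := tendsto_measure_iUnion_atTop (μ := μ) hmono
  rw [hU] at ht
  have hmeas : MeasurableSet (⋃ i, s i) := MeasurableSet.iUnion fun i => (hs i).1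
  refine ⟨hmeas, hfin, ?_⟩
  refine hM.mem_of_tendsto (tendsto_indicatorConstLp_set (l := Filter.atTop)
    (t := fun F : Finset ι => ⋃ i ∈ F, s i) (ht := fun F => (hF F).1)
    (hμt := fun F => (hF F).2.1) (by simp) ?_) (Filter.Eventually.of_forall fun F => (hF F).2.2)
  have hsub : ∀ F : Finset ι, ⋃ i ∈ F, s i ⊆ ⋃ i, s i := fun F =>
    Set.iUnion₂_subset fun i _ => Set.subset_iUnion s i
  have heq : ∀ F : Finset ι, μ (symmDiff (⋃ i ∈ F, s i) (⋃ i, s i)) =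
      μ (⋃ i, s i) - μ (⋃ i ∈ F, s i) := by
    intro F
    rw [symmDiff_of_le (hsub F)]
    exact measure_sdiff (hsub F) (hF F).1.nullMeasurableSet (hF F).2.1
  simp only [heq]
  have := ENNReal.Tendsto.sub (tendsto_const_nhds (x := μ (⋃ i, s i))) ht (Or.inl hfin)
  simpa using this

theorem eq_top_of_indicatorMem (hM : IsClosed (M : Set (Lp ℝ 1 μ)))
    (h : ∀ s, MeasurableSet s → μ s ≠ ⊤ → IndicatorMem M s) : M = ⊤ := by
  refine eq_top_iff.2 fun f _ => ?_
  refine Lp.induction (by simp) (motive := fun f => f ∈ M) ?_ ?_ hM f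
  · intro c s hs hfin
    rw [Lp.simpleFunc.coe_indicatorConst]
    obtain ⟨_, _, h1⟩ := h s hs hfin.ne
    have : indicatorConstLp 1 hs hfin.ne c = c • indicatorConstLp (μ := μ) 1 hs hfin.ne (1 : ℝ) := by
      refine Lp.ext ?_
      refine indicatorConstLp_coeFn.trans ?_
      refine Filter.EventuallyEq.trans ?_ (Lp.coeFn_smul _ _).symm
      filter_upwards [indicatorConstLp_coeFn (p := 1) (hs := hs) (hμs := hfin.ne) (c := (1 : ℝ))]
        with x hx
      rw [Pi.smul_apply, hx]
      by_cases hxs : x ∈ s <;> simp [hxs]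
    rw [this]
    exact M.smul_mem c h1
  · intro f g hf hg _ h1 h2
    exact M.add_mem h1 h2

end IndicatorMem

/-! ### Density of the span of the indicators of `Y(k, v)`. -/

section Density

theorem pairwise_disjoint_placesOver (k : FiniteGaloisIntermediateField ℚ Qbar) :
    Pairwise (Function.onFun Disjoint fun v : Place k => placesOver k.toIntermediateField v) := by
  intro v w hvw
  refine Set.disjoint_left.2 fun y hv hw => hvw ?_
  exact (show y.comap _ = v from hv).symm.trans hw

theorem pairwise_disjoint_fiber : Pairwise (Function.onFun Disjoint fiber) := by
  intro v w hvw
  refine Set.disjoint_left.2 fun y hv hw => hvw ?_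
  exact (show y.res = v from hv).symm.trans hw

theorem iUnion_fiber : ⋃ u, fiber u = Set.univ :=
  Set.eq_univ_of_forall fun y => Set.mem_iUnion.2 ⟨y.res, rfl⟩

/-- The sets of places determined by the restriction to some finite Galois extension of `ℚ`. -/
def cylinders : Set (Set (Place Qbar)) :=
  {s | ∃ (k : FiniteGaloisIntermediateField ℚ Qbar) (A : Set (Place k)),
    s = ⋃ v ∈ A, placesOver k.toIntermediateField v}

theorem mem_biUnion_placesOver {k : FiniteGaloisIntermediateField ℚ Qbar} {A : Set (Place k)}
    {y : Place Qbar} : y ∈ ⋃ v ∈ A, placesOver k.toIntermediateField v ↔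
      y.comap (algebraMap k Qbar) ∈ A := by
  simp [placesOver]

/-- Conditions on the restrictions to `k` and to `l` are both conditions on the restriction to the
compositum. -/
theorem isPiSystem_cylinders : IsPiSystem cylinders := by
  rintro _ ⟨k, A, rfl⟩ _ ⟨l, B, rfl⟩ -
  refine ⟨k ⊔ l, {v | v.comap (IntermediateField.inclusion
    (show k.toIntermediateField ≤ (k ⊔ l).toIntermediateField from le_sup_left)).toRingHom ∈ A ∧
    v.comap (IntermediateField.inclusion
    (show l.toIntermediateField ≤ (k ⊔ l).toIntermediateField from le_sup_right)).toRingHom ∈ B},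
    ?_⟩
  ext y
  rw [Set.mem_inter_iff, mem_biUnion_placesOver, mem_biUnion_placesOver, mem_biUnion_placesOver]
  rfl

theorem measurableSpace_eq_generateFrom_cylinders :
    (inferInstance : MeasurableSpace (Place Qbar)) = MeasurableSpace.generateFrom cylinders := by
  refine le_antisymm ?_ (MeasurableSpace.generateFrom_le ?_)
  · refine measurableSpace_eq_generateFrom.trans_le (MeasurableSpace.generateFrom_mono ?_)
    rintro _ ⟨⟨k, v⟩, rfl⟩
    exact ⟨k, {v}, by simp⟩
  · rintro _ ⟨k, A, rfl⟩
    exact MeasurableSet.biUnion A.to_countable fun v _ => measurableSet_placesOver k v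

/-- The indicator functions of the sets `Y(k, v)` span a dense subspace of `L¹`. -/
theorem eq_top_of_placesOver {M : Submodule ℝ L1} (hM : IsClosed (M : Set L1))
    (h : ∀ (k : FiniteGaloisIntermediateField ℚ Qbar) (v : Place k),
      IndicatorMem M (placesOver k.toIntermediateField v)) : M = ⊤ := by
  -- A cylinder can have infinite measure. Inside a fibre, which has measure `1`, only finitely many
  -- places of `k` remain.
  have hcyl : ∀ s ∈ cylinders, ∀ u, IndicatorMem M (s ∩ fiber u) := by
    rintro _ ⟨k, A, rfl⟩ u
    have hfin : (A ∩ {v | v.res = u}).Finite := (finite_res_eq k u).inter_of_right A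
    have : (⋃ v ∈ A, placesOver k.toIntermediateField v) ∩ fiber u =
        ⋃ v ∈ hfin.toFinset, placesOver k.toIntermediateField v := by
      rw [show ⋃ v ∈ hfin.toFinset, placesOver k.toIntermediateField v =
        ⋃ v ∈ A ∩ {v | v.res = u}, placesOver k.toIntermediateField v by
          simp only [Set.Finite.mem_toFinset]]
      ext y
      rw [Set.mem_inter_iff, mem_biUnion_placesOver, mem_biUnion_placesOver]
      exact and_congr_right fun _ => by rw [Set.mem_ofPred_eq, Place.res_comap]; rfl
    rw [this]
    exact IndicatorMem.biUnion_finset _ (fun v _ => h k v) (pairwise_disjoint_placesOver k)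
  have hfib : ∀ u, IndicatorMem M (fiber u) := by
    intro u
    have := hcyl Set.univ ⟨⊥, Set.univ, by
      ext y
      rw [mem_biUnion_placesOver]
      simp⟩ u
    rwa [Set.univ_inter] at this
  have hall : ∀ s, MeasurableSet s → ∀ u, IndicatorMem M (s ∩ fiber u) := by
    intro s hs u
    refine MeasurableSpace.induction_on_inter
      (C := fun s _ => IndicatorMem M (s ∩ fiber u)) measurableSpace_eq_generateFrom_cylinders
      isPiSystem_cylinders ?_ (fun t ht => hcyl t ht u) ?_ ?_ s hs
    · rw [Set.empty_inter]
      exact IndicatorMem.empty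
    · intro t _ ht
      have : tᶜ ∩ fiber u = fiber u \ (t ∩ fiber u) := by
        ext y
        simp only [Set.mem_inter_iff, Set.mem_compl_iff, Set.mem_sdiff]
        tauto
      rw [this]
      exact ht.diff (hfib u) Set.inter_subset_right
    · intro f hd _ hf
      rw [Set.iUnion_inter]
      refine IndicatorMem.iUnion hM hf (fun i j hij => ?_) ?_
      · exact (hd hij).mono Set.inter_subset_left Set.inter_subset_left
      · rw [← Set.iUnion_inter]
        exact measure_ne_top_of_subset Set.inter_subset_right (hfib u).2.1
  refine eq_top_of_indicatorMem hM fun s hs hfin => ?_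
  have : s = ⋃ u, s ∩ fiber u := by rw [← Set.inter_iUnion, iUnion_fiber, Set.inter_univ]
  rw [this]
  refine IndicatorMem.iUnion hM (hall s hs) (fun i j hij => ?_) (this ▸ hfin)
  exact (pairwise_disjoint_fiber hij).mono Set.inter_subset_right Set.inter_subset_right

end Density

/-! ### Finite places and prime ideals; infinite places. -/

section NumberField

open NumberField

variable {k : Type*} [Field k]

theorem Place.IsOverPrime.abv_integer_le {v : Place k} {p : ℕ} (h : v.IsOverPrime p) (a : 𝓞 k) :
    v.abv a ≤ 1 :=
  h.abv_le_one_of_isIntegral (RingOfIntegers.isIntegral_coe a)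

/-- The prime ideal of the ring of integers attached to a place over a prime number. -/
def Place.IsOverPrime.ideal {v : Place k} {p : ℕ} (h : v.IsOverPrime p) : Ideal (𝓞 k) where
  carrier := {a | v.abv a < 1}
  zero_mem' := by simp
  add_mem' {a b} ha hb := by
    have := h.isNonarchimedean (a : k) b
    simp only [Set.mem_ofPred_eq, map_add] at ha hb ⊢
    exact this.trans_lt (max_lt ha hb)
  smul_mem' a b hb := by
    simp only [Set.mem_ofPred_eq, smul_eq_mul, map_mul] at hb ⊢
    exact mul_lt_one_of_nonneg_of_lt_one_right (h.abv_integer_le a) (v.abv.nonneg _) hb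

section

variable {v w : Place k} {p q : ℕ} (hv : v.IsOverPrime p) (hw : w.IsOverPrime q)

include hv

theorem Place.IsOverPrime.mem_ideal {a : 𝓞 k} : a ∈ hv.ideal ↔ v.abv a < 1 := Iff.rfl

theorem Place.IsOverPrime.notMem_ideal {a : 𝓞 k} : a ∉ hv.ideal ↔ v.abv a = 1 := by
  rw [hv.mem_ideal, not_lt]
  exact ⟨fun h => le_antisymm (hv.abv_integer_le a) h, fun h => h.ge⟩

theorem Place.IsOverPrime.natCast_mem_ideal : (p : 𝓞 k) ∈ hv.ideal := by
  rw [hv.mem_ideal, show (((p : 𝓞 k)) : k) = (p : k) from map_natCast (algebraMap (𝓞 k) k) p,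
    hv.abv_natCast_self]
  exact inv_lt_one_of_one_lt₀ (by exact_mod_cast hv.1.one_lt)

theorem Place.IsOverPrime.isPrime_ideal : hv.ideal.IsPrime where
  ne_top' := by
    rw [Ideal.ne_top_iff_one, hv.notMem_ideal]
    simp
  mem_or_mem' {a b} hab := by
    by_contra! h
    rw [hv.notMem_ideal, hv.notMem_ideal] at h
    rw [hv.mem_ideal, show ((a * b : 𝓞 k) : k) = (a : k) * b from map_mul (algebraMap (𝓞 k) k) a b,
      map_mul, h.1, h.2] at hab
    simp at hab

variable [NumberField k]

theorem Place.IsOverPrime.ideal_ne_bot : hv.ideal ≠ ⊥ := by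
  intro h
  have := hv.natCast_mem_ideal
  rw [h, Ideal.mem_bot] at this
  exact hv.1.ne_zero (by exact_mod_cast this)

/-- A power of the prime ideal attached to a place is principal. -/
theorem Place.IsOverPrime.exists_ideal_pow_eq_span :
    ∃ h : ℕ, h ≠ 0 ∧ ∃ π : 𝓞 k, hv.ideal ^ h = Ideal.span {π} := by
  let P : nonZeroDivisors (Ideal (𝓞 k)) :=
    ⟨hv.ideal, mem_nonZeroDivisors_of_ne_zero hv.ideal_ne_bot⟩
  refine ⟨Fintype.card (ClassGroup (𝓞 k)), Fintype.card_ne_zero, ?_⟩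
  -- The class number kills the class of every ideal.
  have h1 : ClassGroup.mk0 (P ^ Fintype.card (ClassGroup (𝓞 k))) = 1 := by
    rw [map_pow, pow_card_eq_one]
  have h2 := (ClassGroup.mk0_eq_one_iff (P ^ Fintype.card (ClassGroup (𝓞 k))).2).1 h1
  exact ⟨_, (Ideal.span_singleton_generator _).symm⟩

/-- A prime containing a power of `hv.ideal` contains `hv.ideal`, which is maximal. So `π` is a unit
at every other prime. -/
theorem Place.IsOverPrime.ideal_le_of_pow_eq_span {h : ℕ} {π : 𝓞 k}
    (hπ : hv.ideal ^ h = Ideal.span {π}) {I : Ideal (𝓞 k)} (hI : I.IsPrime) (hπI : π ∈ I) :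
    hv.ideal = I := by
  have h1 : hv.ideal ≤ I := by
    refine hI.le_of_pow_le (n := h) ?_
    rw [hπ, Ideal.span_singleton_le_iff_mem]
    exact hπI
  have : hv.ideal.IsMaximal := hv.isPrime_ideal.isMaximal hv.ideal_ne_bot
  exact this.eq_of_le hI.ne_top h1

/-- Write `(a) = P ^ m * I` with `P = hv.ideal` not dividing `I`. Taking `h`-th powers makes the
first factor `(π ^ m)`, and `c` generates `I ^ h`. -/
theorem Place.IsOverPrime.pow_eq_pow_mul {h : ℕ} {π : 𝓞 k}
    (hπ : hv.ideal ^ h = Ideal.span {π}) {a : 𝓞 k} (ha : a ≠ 0) :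
    ∃ m : ℕ, ∃ c ∉ hv.ideal, a ^ h = π ^ m * c := by
  have hprime : Prime hv.ideal := Ideal.prime_of_isPrime hv.ideal_ne_bot hv.isPrime_ideal
  have hspan : Ideal.span {a} ≠ ⊥ := by simpa using ha
  obtain ⟨I, hI, hmI⟩ :=
    (FiniteMultiplicity.of_prime_left hprime hspan).exists_eq_pow_mul_and_not_dvd
  set m := multiplicity hv.ideal (Ideal.span {a})
  have h1 : Ideal.span {a ^ h} = Ideal.span {π ^ m} * I ^ h := by
    rw [← Ideal.span_singleton_pow, hI, mul_pow, ← pow_mul, mul_comm m h, pow_mul, hπ,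
      Ideal.span_singleton_pow]
  have h2 : a ^ h ∈ Ideal.span {π ^ m} := Ideal.dvd_span_singleton.1 (Dvd.intro _ h1.symm)
  obtain ⟨c, hc⟩ := Ideal.mem_span_singleton.1 h2
  refine ⟨m, c, fun hcP => ?_, hc⟩
  have hne : Ideal.span {π ^ m} ≠ ⊥ := by
    intro h0
    rw [h0, Ideal.mem_bot] at h2
    exact pow_ne_zero h ha h2
  have h3 : Ideal.span {c} = I ^ h := by
    refine mul_left_cancel₀ hne ?_
    rw [← h1, hc, Ideal.span_singleton_mul_span_singleton]
  have h4 : hv.ideal ∣ I ^ h := by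
    rw [← h3, Ideal.dvd_span_singleton]
    exact hcP
  exact hmI (hprime.dvd_of_dvd_pow h4)

include hw

/-- By `pow_eq_pow_mul`, `|a| ^ h = |π| ^ m` at both places with the same `m`, and `|π| < 1` at
both. Comparing exponents shows equivalence, and the residue characteristic fixes the normalization.
-/
theorem Place.eq_of_ideal_eq (hI : hv.ideal = hw.ideal) : v = w := by
  have hpq : p = q := by
    by_contra hne
    have h1 : (p : 𝓞 k) ∈ hw.ideal := hI ▸ hv.natCast_mem_ideal
    rw [hw.mem_ideal,
      show (((p : 𝓞 k)) : k) = (p : k) from map_natCast (algebraMap (𝓞 k) k) p] at h1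
    have : Fact p.Prime := ⟨hv.1⟩
    have : Fact q.Prime := ⟨hw.1⟩
    have h2 := hw.2 p
    rw [padicNorm.padicNorm_of_prime_of_ne (Ne.symm hne), Rat.cast_natCast] at h2
    rw [h2] at h1
    simp at h1
  subst hpq
  refine Place.eq_of_isEquiv ?_ (Place.eq_of_isOverPrime (Place.isOverPrime_res.2 hv)
    (Place.isOverPrime_res.2 hw))
  obtain ⟨h, hh, π, hπ⟩ := hv.exists_ideal_pow_eq_span
  have hπv : v.abv π < 1 := by
    rw [← hv.mem_ideal]
    exact Ideal.pow_le_self hh (hπ ▸ Ideal.mem_span_singleton_self π)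
  have hπw : w.abv π < 1 := by
    rw [← hw.mem_ideal, ← hI]
    exact hπv
  have hπ0 : (π : k) ≠ 0 := by
    intro h0
    have h1 : π = 0 := by exact_mod_cast h0
    rw [h1, Ideal.span_singleton_eq_bot.2 rfl] at hπ
    exact pow_ne_zero h hv.ideal_ne_bot hπ
  have key : ∀ a : 𝓞 k, a ≠ 0 → ∃ m : ℕ, v.abv a ^ h = v.abv π ^ m ∧ w.abv a ^ h = w.abv π ^ m := by
    intro a ha
    obtain ⟨m, c, hc, hac⟩ := hv.pow_eq_pow_mul hπ ha
    have hac' : (a : k) ^ h = (π : k) ^ m * c := by exact_mod_cast congrArg (algebraMap (𝓞 k) k) hac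
    refine ⟨m, ?_, ?_⟩
    · rw [← map_pow, hac', map_mul, map_pow, hv.notMem_ideal.1 hc, mul_one]
    · have hc' : c ∉ hw.ideal := hI ▸ hc
      rw [← map_pow, hac', map_mul, map_pow, hw.notMem_ideal.1 hc', mul_one]
  refine AbsoluteValue.isEquiv_of_lt_one_imp v.isNontrivial fun x hx => ?_
  obtain ⟨a, b, hb, rfl⟩ := IsFractionRing.div_surjective (A := 𝓞 k) x
  by_cases ha : a = 0
  · simp [ha]
  have hb0 : b ≠ 0 := nonZeroDivisors.ne_zero hb
  have hbk : (algebraMap (𝓞 k) k b) ≠ 0 := by simpa using hb0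
  rw [map_div₀, div_lt_one (AbsoluteValue.pos _ hbk)] at hx ⊢
  obtain ⟨m, hm1, hm2⟩ := key a ha
  obtain ⟨n, hn1, hn2⟩ := key b hb0
  have h1 : v.abv π ^ m < v.abv π ^ n := by
    rw [← hm1, ← hn1]
    exact pow_lt_pow_left₀ hx (v.abv.nonneg _) hh
  have h2 : n < m := (pow_lt_pow_iff_right_of_lt_one₀ (v.abv.pos hπ0) hπv).1 h1
  have h3 : w.abv π ^ m < w.abv π ^ n :=
    (pow_lt_pow_iff_right_of_lt_one₀ (w.abv.pos hπ0) hπw).2 h2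
  rw [← hm2, ← hn2] at h3
  exact lt_of_pow_lt_pow_left₀ h (w.abv.nonneg _) h3

end

/-- For a place over a prime number there is an element which is a unit at all other such
places. -/
theorem Place.IsOverPrime.exists_abv_eq_one [NumberField k] {v : Place k} {p : ℕ} (hv : v.IsOverPrime p) :
    ∃ π : k, π ≠ 0 ∧ v.abv π ≠ 1 ∧ ∀ (w : Place k) (q : ℕ), w.IsOverPrime q → w ≠ v →
      w.abv π = 1 := by
  obtain ⟨h, hh, π, hπ⟩ := hv.exists_ideal_pow_eq_span
  have hπv : v.abv π < 1 := by
    rw [← hv.mem_ideal]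
    exact Ideal.pow_le_self hh (hπ ▸ Ideal.mem_span_singleton_self π)
  refine ⟨π, ?_, hπv.ne, fun w q hw hwv => ?_⟩
  · intro h0
    have h1 : π = 0 := by exact_mod_cast h0
    rw [h1, Ideal.span_singleton_eq_bot.2 rfl] at hπ
    exact pow_ne_zero h hv.ideal_ne_bot hπ
  · rw [← hw.notMem_ideal]
    intro hmem
    exact hwv (Place.eq_of_ideal_eq hv hw
      (hv.ideal_le_of_pow_eq_span hπ hw.isPrime_ideal hmem)).symm

/-- The place attached to an infinite place of a number field. -/
def ofInfinitePlace (w : InfinitePlace k) : Place k :=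
  ⟨w.1, Or.inl fun q => by
    rw [← InfinitePlace.mk_embedding w]
    change ‖w.embedding (q : k)‖ = _
    rw [map_ratCast, ← Complex.ofReal_ratCast, Complex.norm_real, Real.norm_eq_abs]⟩

theorem ofInfinitePlace_abv (w : InfinitePlace k) (x : k) : (ofInfinitePlace w).abv x = w x := rfl

theorem isInfinite_ofInfinitePlace (w : InfinitePlace k) : (ofInfinitePlace w).IsInfinite :=
  fun q => by
    rw [ofInfinitePlace_abv, ← InfinitePlace.norm_embedding_eq, map_ratCast,
      ← Complex.ofReal_ratCast, Complex.norm_real, Real.norm_eq_abs]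

/-- By transitivity `v` is a Galois translate of a place given by a complex embedding, hence is
itself given by one. -/
theorem exists_ofInfinitePlace_eq [NumberField k] [IsGalois ℚ k] {v : Place k} (hv : v.IsInfinite) :
    ∃ w : InfinitePlace k, ofInfinitePlace w = v := by
  obtain ⟨w⟩ := (inferInstance : Nonempty (InfinitePlace k))
  obtain ⟨σ, rfl⟩ := Place.exists_smul_eq_of_finite (v := ofInfinitePlace w) (w := v)
    (Place.eq_of_isInfinite (Place.isInfinite_res.2 (isInfinite_ofInfinitePlace w))
      (Place.isInfinite_res.2 hv))
  refine ⟨InfinitePlace.mk (w.embedding.comp ((σ⁻¹ : k ≃ₐ[ℚ] k) : k →+* k)), ?_⟩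
  ext x
  rw [ofInfinitePlace_abv, smul_abv, ofInfinitePlace_abv, InfinitePlace.apply,
    ← InfinitePlace.norm_embedding_eq w]
  rfl

end NumberField

/-! ### Passage between `X` and `L¹`. -/

section Projection

/-- The indicator function of the set of all places over a place of `ℚ`. -/
def fiberIndicator (u : Place ℚ) : L1 :=
  indicatorConstLp 1 (measurableSet_fiber u) (by simp [placeMeasure_fiber]) (1 : ℝ)

theorem integral_fiberIndicator (u : Place ℚ) : ∫ y, fiberIndicator u y ∂placeMeasure = 1 := by
  rw [fiberIndicator, integral_indicatorConstLp]
  simp [Measure.real, placeMeasure_fiber]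

theorem mem_X_iff {F : L1} : F ∈ X ↔ L1.integralCLM (E := ℝ) F = 0 := by
  change ∫ y, F y ∂placeMeasure = 0 ↔ _
  rw [← L1.integral_eq_integral, L1.integral_def]

theorem integralCLM_fiberIndicator (u : Place ℚ) :
    L1.integralCLM (E := ℝ) (fiberIndicator u) = 1 := by
  rw [← L1.integral_eq, L1.integral_eq_integral, integral_fiberIndicator]

/-- The projection of `L¹` onto `X` along the indicator function of the infinite places. -/
def projX : L1 →L[ℝ] X :=
  (ContinuousLinearMap.id ℝ L1 -
    (L1.integralCLM (E := ℝ)).smulRight (fiberIndicator infPlace)).codRestrict X fun F => by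
      rw [mem_X_iff]
      simp [integralCLM_fiberIndicator]

theorem projX_apply_coe (F : X) : projX F = F := by
  refine Subtype.ext ?_
  change (F : L1) - L1.integralCLM (E := ℝ) (F : L1) • fiberIndicator infPlace = F
  rw [mem_X_iff.1 F.2, zero_smul, sub_zero]

theorem projX_fiberIndicator : projX (fiberIndicator infPlace) = 0 := by
  refine Subtype.ext ?_
  change fiberIndicator infPlace -
    L1.integralCLM (E := ℝ) (fiberIndicator infPlace) • fiberIndicator infPlace = 0
  rw [integralCLM_fiberIndicator, one_smul, sub_self]

/-- The functions whose projection to `X` is a limit of logarithms of absolute values of algebraic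
numbers. -/
def logSpan : Submodule ℝ L1 := (XK ⊤).comap projX.toLinearMap

theorem isClosed_logSpan : IsClosed (logSpan : Set L1) :=
  (isClosed_closure (s := (DK ⊤ : Set X))).preimage projX.continuous

theorem coe_mem_logSpan {F : X} : (F : L1) ∈ logSpan ↔ F ∈ XK ⊤ := by
  change projX F ∈ XK ⊤ ↔ _
  rw [projX_apply_coe]

theorem logElem_mem_logSpan {α : Qbar} (hα : α ≠ 0) : (logElem α hα : L1) ∈ logSpan :=
  coe_mem_logSpan.2 (logElem_mem_XK hα trivial)

/-- This function spans the kernel of `projX`. It supplies the one dimension by which `L¹` exceeds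
`X`, so that single indicators can be treated. -/
theorem fiberIndicator_mem_logSpan : fiberIndicator infPlace ∈ logSpan := by
  change projX _ ∈ XK ⊤
  rw [projX_fiberIndicator]
  exact (XK ⊤).zero_mem

end Projection

/-! ### Indicators of `Y(k, v)` from units and generators of prime powers. -/

section Step

variable (k : FiniteGaloisIntermediateField ℚ Qbar)

/-- The indicator function of the set of places over a place of a finite Galois extension. -/
def placeIndicator (v : Place k) : L1 :=
  indicatorConstLp 1 (measurableSet_placesOver k v) (placeMeasure_placesOver_lt_top k v).ne (1 : ℝ)

theorem sum_smul_placeIndicator_ae (T : Finset (Place k)) (c : Place k → ℝ) :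
    (∑ v ∈ T, c v • placeIndicator k v : L1) =ᵐ[placeMeasure] fun y =>
      ∑ v ∈ T, c v * (placesOver k.toIntermediateField v).indicator (fun _ => (1 : ℝ)) y := by
  refine (Lp.coeFn_fun_finsetSum _ _).trans ?_
  have h : ∀ v : Place k, ((c v • placeIndicator k v : L1) : Place Qbar → ℝ) =ᵐ[placeMeasure]
      fun y => c v * (placesOver k.toIntermediateField v).indicator (fun _ => (1 : ℝ)) y := by
    intro v
    refine (Lp.coeFn_smul _ _).trans ?_
    filter_upwards [indicatorConstLp_coeFn (p := 1) (hs := measurableSet_placesOver k v)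
      (hμs := (placeMeasure_placesOver_lt_top k v).ne) (c := (1 : ℝ))] with y hy
    exact congrArg (c v * ·) hy
  filter_upwards [(ae_ball_iff T.countable_toSet).2 fun v _ => h v] with y hy
  exact Finset.sum_congr rfl fun v hv => hy v hv

theorem sum_mul_indicator_of_mem {T : Finset (Place k)} (c : Place k → ℝ) {y : Place Qbar}
    (hy : y.comap (algebraMap k Qbar) ∈ T) :
    ∑ v ∈ T, c v * (placesOver k.toIntermediateField v).indicator (fun _ => (1 : ℝ)) y =
      c (y.comap (algebraMap k Qbar)) := by
  rw [Finset.sum_eq_single_of_mem _ hy]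
  · rw [Set.indicator_of_mem (show y ∈ placesOver _ _ from rfl), mul_one]
  · intro v _ hne
    rw [Set.indicator_of_notMem (fun h => hne h.symm), mul_zero]

theorem sum_mul_indicator_of_notMem {T : Finset (Place k)} (c : Place k → ℝ) {y : Place Qbar}
    (hy : y.comap (algebraMap k Qbar) ∉ T) :
    ∑ v ∈ T, c v * (placesOver k.toIntermediateField v).indicator (fun _ => (1 : ℝ)) y = 0 := by
  refine Finset.sum_eq_zero fun v hv => ?_
  rw [Set.indicator_of_notMem (fun h => hy (by rwa [show y.comap _ = v from h])), mul_zero]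

theorem coe_logElem_eq_sum {α : k} (hα : algebraMap k Qbar α ≠ 0) {T : Finset (Place k)}
    (hT : ∀ v ∉ T, v.abv α = 1) :
    (logElem (algebraMap k Qbar α) hα : L1) =
      ∑ v ∈ T, Real.log (v.abv α) • placeIndicator k v := by
  refine Lp.ext ((coeFn_logElem hα).trans (.trans ?_ (sum_smul_placeIndicator_ae k T _).symm))
  refine Filter.Eventually.of_forall fun y => ?_
  dsimp only
  have hy : logAbs (algebraMap k Qbar α) y =
      Real.log ((y.comap (algebraMap k Qbar)).abv α) := rfl
  by_cases h : y.comap (algebraMap k Qbar) ∈ T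
  · rw [sum_mul_indicator_of_mem k (fun v => Real.log (v.abv α)) h, hy]
  · rw [sum_mul_indicator_of_notMem k (fun v => Real.log (v.abv α)) h, hy, hT _ h, Real.log_one]

/-- The infinite places of a finite Galois extension. -/
def infinitePlaces : Finset (Place k) := (finite_res_eq k infPlace).toFinset

theorem mem_infinitePlaces {v : Place k} : v ∈ infinitePlaces k ↔ v.IsInfinite := by
  rw [infinitePlaces, Set.Finite.mem_toFinset, Set.mem_ofPred_eq, ← Place.isInfinite_res]
  exact ⟨fun h => h ▸ isInfinite_infPlace, fun h => Place.eq_of_isInfinite h isInfinite_infPlace⟩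

theorem fiberIndicator_eq_sum :
    fiberIndicator infPlace = ∑ v ∈ infinitePlaces k, (1 : ℝ) • placeIndicator k v := by
  refine Lp.ext (.trans indicatorConstLp_coeFn
    (.trans ?_ (sum_smul_placeIndicator_ae k _ fun _ => 1).symm))
  refine Filter.Eventually.of_forall fun y => ?_
  have hiff : y ∈ fiber infPlace ↔ y.comap (algebraMap k Qbar) ∈ infinitePlaces k := by
    rw [infinitePlaces, Set.Finite.mem_toFinset, Set.mem_ofPred_eq, Place.res_comap]
    rfl
  by_cases h : y ∈ fiber infPlace
  · rw [Set.indicator_of_mem h]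
    exact (sum_mul_indicator_of_mem k (fun _ => 1) (hiff.1 h)).symm
  · rw [Set.indicator_of_notMem h]
    exact (sum_mul_indicator_of_notMem k (fun _ => 1) (fun h1 => h (hiff.2 h1))).symm

open NumberField NumberField.Units NumberField.Units.dirichletUnitTheorem

instance : NumberField k where
  to_charZero := inferInstance
  to_finiteDimensional := inferInstance

/-- By Dirichlet's unit theorem the values at all but one of the infinite places can be
prescribed. -/
theorem exists_sum_infinitePlaces_mem (x : logSpace k) :
    ∃ (g : Place k → ℝ) (H : X), H ∈ XK ⊤ ∧
      (H : L1) = ∑ v ∈ infinitePlaces k, g v • placeIndicator k v ∧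
      ∀ w : {w : InfinitePlace k // w ≠ w₀}, (w.1.mult : ℝ) * g (ofInfinitePlace w.1) = x w := by
  have hx : x ∈ Submodule.span ℝ (unitLattice k : Set (logSpace k)) := by
    rw [unitLattice_span_eq_top]
    trivial
  induction hx using Submodule.span_induction with
  | mem x hx =>
    obtain ⟨u, -, rfl⟩ := hx
    have hu : algebraMap k Qbar (algebraMap (𝓞 k) k (u.toMul : (𝓞 k)ˣ)) ≠ 0 := by simp
    refine ⟨fun v => Real.log (v.abv (algebraMap (𝓞 k) k (u.toMul : (𝓞 k)ˣ))),
      logElem _ hu, logElem_mem_XK _ trivial, coe_logElem_eq_sum k hu fun v hv => ?_,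
      fun w => rfl⟩
    -- At a finite place both the unit and its inverse have absolute value at most `1`.
    rw [mem_infinitePlaces] at hv
    obtain ⟨p, hp⟩ := v.isInfinite_or.resolve_left hv
    refine le_antisymm (hp.abv_integer_le _) ?_
    have h1 := hp.abv_integer_le ((u.toMul⁻¹ : (𝓞 k)ˣ) : 𝓞 k)
    have h2 : v.abv (algebraMap (𝓞 k) k (u.toMul : (𝓞 k)ˣ)) *
        v.abv (algebraMap (𝓞 k) k ((u.toMul⁻¹ : (𝓞 k)ˣ) : 𝓞 k)) = 1 := by
      rw [← map_mul, ← map_mul, Units.mul_inv, map_one, map_one]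
    by_contra! hlt
    have h3 := mul_lt_one_of_nonneg_of_lt_one_left (v.abv.nonneg _) hlt h1
    exact absurd h2 h3.ne
  | zero => exact ⟨0, 0, (XK ⊤).zero_mem, by simp, by simp⟩
  | add x y _ _ hx hy =>
    obtain ⟨g, G, hG, hGs, hgx⟩ := hx
    obtain ⟨h, H, hH, hHs, hhy⟩ := hy
    refine ⟨g + h, G + H, (XK ⊤).add_mem hG hH, ?_, fun w => ?_⟩
    · rw [Submodule.coe_add, hGs, hHs, ← Finset.sum_add_distrib]
      simp only [Pi.add_apply, add_smul]
    · rw [Pi.add_apply, mul_add, hgx, hhy, Pi.add_apply]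
  | smul c x _ hx =>
    obtain ⟨g, G, hG, hGs, hgx⟩ := hx
    refine ⟨c • g, c • G, (XK ⊤).smul_mem c hG, ?_, fun w => ?_⟩
    · rw [Submodule.coe_smul, hGs, Finset.smul_sum]
      simp only [Pi.smul_apply, smul_eq_mul, mul_smul]
    · rw [Pi.smul_apply, Pi.smul_apply, ← hgx, smul_eq_mul, smul_eq_mul, mul_left_comm]

theorem sum_infinitePlaces_sub_single {g : Place k → ℝ} {v₀ : Place k}
    (hv₀ : v₀ ∈ infinitePlaces k) {M : Submodule ℝ L1}
    (hM : ∀ v ∈ infinitePlaces k, v ≠ v₀ → g v • placeIndicator k v ∈ M)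
    (hsum : ∑ v ∈ infinitePlaces k, g v • placeIndicator k v ∈ M) :
    g v₀ • placeIndicator k v₀ ∈ M := by
  classical
  rw [← Finset.add_sum_erase _ _ hv₀] at hsum
  refine (M.add_mem_iff_left ?_).1 hsum
  exact M.sum_mem fun v hv => hM v (Finset.mem_of_mem_erase hv) (Finset.ne_of_mem_erase hv)

/-- Units prescribe the values at all infinite places except the distinguished `v₀`. The indicator
at `v₀` is obtained separately; any other one then follows by prescribing `1` there, `0` elsewhere,
and removing the `v₀` term. -/
theorem placeIndicator_mem_logSpan_of_isInfinite {v : Place k} (hv : v.IsInfinite) :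
    placeIndicator k v ∈ logSpan := by
  classical
  have hex : ∀ v ∈ infinitePlaces k, ∃ w : InfinitePlace k, ofInfinitePlace w = v := fun v hv =>
    exists_ofInfinitePlace_eq ((mem_infinitePlaces k).1 hv)
  set v₀ : Place k := ofInfinitePlace (w₀ : InfinitePlace k)
  have hv₀ : v₀ ∈ infinitePlaces k := (mem_infinitePlaces k).2 (isInfinite_ofInfinitePlace _)
  have hmem : placeIndicator k v₀ ∈ logSpan := by
    -- Prescribing the local degrees makes `g = 1` off `v₀`, so subtracting the indicator of all
    -- infinite places leaves only the term at `v₀`.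
    obtain ⟨g, H, hH, hHs, hg⟩ := exists_sum_infinitePlaces_mem k fun w => (w.1.mult : ℝ)
    have hg1 : ∀ v ∈ infinitePlaces k, v ≠ v₀ → g v = 1 := by
      intro v hv hne
      obtain ⟨w, rfl⟩ := hex v hv
      have hw := hg ⟨w, fun h => hne (by rw [h])⟩
      exact mul_left_cancel₀ InfinitePlace.mult_coe_ne_zero (hw.trans (mul_one _).symm)
    have h1 : ∑ v ∈ infinitePlaces k, (g v - 1) • placeIndicator k v ∈ logSpan := by
      simp only [sub_smul, Finset.sum_sub_distrib]
      rw [← hHs, ← fiberIndicator_eq_sum]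
      exact logSpan.sub_mem (coe_mem_logSpan.2 hH) fiberIndicator_mem_logSpan
    have h2 := sum_infinitePlaces_sub_single k (g := fun v => g v - 1) hv₀
      (fun v hv hne => by simp [hg1 v hv hne]) h1
    refine (Submodule.smul_mem_iff _ ?_).1 h2
    -- If the coefficient at `v₀` vanished, `H` would be the indicator of all infinite places, with
    -- integral `1` instead of `0`.
    intro h0
    have h3 : (H : L1) = fiberIndicator infPlace := by
      rw [hHs, fiberIndicator_eq_sum k]
      refine Finset.sum_congr rfl fun v hv => ?_
      by_cases hvv : v = v₀
      · rw [hvv, sub_eq_zero.1 h0]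
      · rw [hg1 v hv hvv]
    have h4 := mem_X_iff.1 H.2
    rw [h3, integralCLM_fiberIndicator] at h4
    exact one_ne_zero h4
  obtain ⟨w, rfl⟩ := exists_ofInfinitePlace_eq hv
  by_cases hw : w = w₀
  · rwa [hw]
  obtain ⟨g, H, hH, hHs, hg⟩ := exists_sum_infinitePlaces_mem k
    (Pi.single ⟨w, hw⟩ (w.mult : ℝ))
  have hvmem : ofInfinitePlace w ∈ infinitePlaces k := (mem_infinitePlaces k).2 hv
  have hgw : g (ofInfinitePlace w) = 1 := by
    have := hg ⟨w, hw⟩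
    rw [Pi.single_eq_same] at this
    exact mul_left_cancel₀ InfinitePlace.mult_coe_ne_zero (this.trans (mul_one _).symm)
  have h1 := sum_infinitePlaces_sub_single k (g := g) (M := logSpan) hvmem
    (fun v hv hne => by
      by_cases hvv : v = v₀
      · rw [hvv]
        exact logSpan.smul_mem _ hmem
      · obtain ⟨w', rfl⟩ := hex v hv
        have hw' := hg ⟨w', fun h => hvv (by rw [h])⟩
        rw [Pi.single_eq_of_ne (fun h => hne (congrArg ofInfinitePlace (Subtype.ext_iff.1 h)))] at hw'
        rw [(mul_eq_zero.1 hw').resolve_left InfinitePlace.mult_coe_ne_zero, zero_smul]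
        exact logSpan.zero_mem)
    (hHs ▸ coe_mem_logSpan.2 hH)
  rwa [hgw, one_smul] at h1

/-- For finite `v`, a generator `π` of a power of its prime has `log |π|` supported on `v` and the
infinite places. The infinite terms are already in the span, and the coefficient at `v` is nonzero.
-/
theorem placeIndicator_mem_logSpan (v : Place k) : placeIndicator k v ∈ logSpan := by
  classical
  rcases v.isInfinite_or with hv | ⟨p, hp⟩
  · exact placeIndicator_mem_logSpan_of_isInfinite k hv
  obtain ⟨π, hπ0, hπv, hπ⟩ := hp.exists_abv_eq_one
  have hα : algebraMap k Qbar π ≠ 0 := by simpa using hπ0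
  have hsum := coe_logElem_eq_sum k hα (T := insert v (infinitePlaces k)) (fun w hw => by
    rw [Finset.mem_insert, not_or, mem_infinitePlaces] at hw
    obtain ⟨q, hq⟩ := w.isInfinite_or.resolve_left hw.2
    exact hπ w q hq hw.1)
  have hmem := logElem_mem_logSpan hα
  have hlog : Real.log (v.abv π) ≠ 0 :=
    Real.log_ne_zero_of_pos_of_ne_one (v.abv.pos hπ0) hπv
  rw [hsum, ← Finset.add_sum_erase _ _ (Finset.mem_insert_self v _)] at hmem
  refine (Submodule.smul_mem_iff _ hlog).1 ((logSpan.add_mem_iff_left ?_).1 hmem)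
  refine logSpan.sum_mem fun w hw => logSpan.smul_mem _ ?_
  rw [Finset.mem_erase, Finset.mem_insert] at hw
  exact placeIndicator_mem_logSpan_of_isInfinite k
    ((mem_infinitePlaces k).1 (hw.2.resolve_left hw.1))

end Step

/-- The logarithms of the absolute values of all algebraic numbers span a dense subspace of `X`. -/
theorem XK_top : XK ⊤ = ⊤ := by
  have h : logSpan = ⊤ := eq_top_of_placesOver isClosed_logSpan fun k v =>
    ⟨measurableSet_placesOver k v, (placeMeasure_placesOver_lt_top k v).ne,
      placeIndicator_mem_logSpan k v⟩
  refine eq_top_iff.2 fun F _ => coe_mem_logSpan.1 ?_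
  rw [h]
  trivial

end WeilHeight

end

theorem theorem6p2 (K : IntermediateField ℚ WeilHeight.Qbar) :
    (∀ α ∈ K, α ≠ 0 → ∃ F : WeilHeight.X,
      ((F : WeilHeight.L1) : WeilHeight.Place WeilHeight.Qbar → ℝ)
        =ᵐ[WeilHeight.placeMeasure] WeilHeight.logAbs α) ∧
    ∃ U : WeilHeight.X →L[ℝ] WeilHeight.X,
      WeilHeight.IsAveraging K U ∧
      (∀ V : WeilHeight.X → WeilHeight.X, WeilHeight.IsAveraging K V → V = U) ∧
      U ∘L U = U ∧
      U.range = WeilHeight.XK K ∧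
      IsCompl (WeilHeight.XK K) U.ker ∧
      (WeilHeight.XK K).ClosedComplemented := by
  have hproj : ∀ x : WeilHeight.XK K, (WeilHeight.averageX K).codRestrict (WeilHeight.XK K) (WeilHeight.averageX_mem_XK WeilHeight.XK_top) x = x :=
    fun x => Subtype.ext (WeilHeight.averageX_eq_self_of_mem_XK x.2)
  refine ⟨fun α _ hα => ⟨WeilHeight.logElem α hα, WeilHeight.coeFn_logElem hα⟩, WeilHeight.averageX K, WeilHeight.isAveraging_averageX K,
    fun V hV => WeilHeight.IsAveraging.eq_averageX hV, ?_, ?_, ?_, _, hproj⟩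
  · ext1 G
    exact WeilHeight.averageX_eq_self_of_mem_XK (WeilHeight.averageX_mem_XK WeilHeight.XK_top G)
  · ext G
    constructor
    · rintro ⟨H, rfl⟩
      exact WeilHeight.averageX_mem_XK WeilHeight.XK_top H
    · intro hG
      exact ⟨G, WeilHeight.averageX_eq_self_of_mem_XK hG⟩
  -- The operator with codomain restricted to `X_K` is a left inverse of the inclusion and has the
  -- same kernel as `U`.
  · have h := LinearMap.isCompl_of_proj (p := WeilHeight.XK K)
      (f := ((WeilHeight.averageX K).codRestrict (WeilHeight.XK K) (WeilHeight.averageX_mem_XK WeilHeight.XK_top)).toLinearMap) hproj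
    convert! h using 1
    ext G
    exact (Subtype.ext_iff (a1 := (WeilHeight.averageX K).codRestrict (WeilHeight.XK K) (WeilHeight.averageX_mem_XK WeilHeight.XK_top) G)
      (a2 := 0)).symm
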